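/- Let $n\ge 1$ and let $B_n$ be the group of bijections $\beta$ of $[-n,n]\setminus\{0\}$ with $\beta(-i)=-\beta(i)$, under composition; write $\beta=[\beta(1),\dots,\beta(n)]$. Let $D_n\subseteq B_n$ be the subgroup of those $\gamma$ for which the number of $i\in\{1,\dots,n\}$ with $\gamma(i)<0$ is even. It is generated by $s_0=[-2,-1,3,\dots,n]$ and $s_i=[1,\dots,i-1,i+1,i,i+2,\dots,n]$ for $1\le i\le n-1$ (no generators if $n=1$). Let $\ell_D$ be the length function of $D_n$ with respect to these generators, and $\mathrm{Des}_D(\gamma)=\{i\in[0,n-1] : \ell_D(\gamma s_i)<\ell_D(\gamma)\}$ (empty if $n=1$). Let $$\mathrm{dmaj}(\gamma)=\sum_{1\le i\le n-1,\ \gamma(i)>\gamma(i+1)} i\;+\sum_{1\le i\le n,\ \gamma(i)<0}(-\gamma(i)-1),$$ that is, the sum of the elements of the multiset $\mathrm{DDes}(\gamma)=\{i\in[1,n-1]:\gamma(i)>\gamma(i+1)\}\uplus\{-\gamma(i)-1:\gamma(i)<0\}\setminus\{0\}$. Put $[k]_q=1+q+\dots+q^{k-1}$, $[k]_q!=[1]_q[2]_q\cdots[k]_q$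 and $\begin{bmatrix} n\\ c_1,\dots,c_r\end{bmatrix}_q=\dfrac{[n]_q!}{[c_1]_q!\cdots[c_r]_q!}$. Theorem. Let $M=\{m_1<m_2<\dots<m_t\}\subseteq[0,n-1]$ (possibly empty), put $m_{t+1}:=n$, and let $D(M)=\{\gamma\in D_n : \mathrm{Des}_D(\gamma^{-1})\subseteq M\}$. Then, with $q$ an indeterminate, $$\sum_{\gamma\in D(M)}q^{\mathrm{dmaj}(\gamma)}=\sum_{\gamma\in D(M)}q^{\ell_D(\gamma)}=\begin{bmatrix} n\\ m_1,\,m_2-m_1,\,\dots,\,n-m_t\end{bmatrix}_q\cdot P,$$ where $$P=\begin{cases}\displaystyle\prod_{i=1}^{n-1}(1+q^i) & \text{if } 0\in M,\\[2mm] \displaystyle\prod_{i=m_1}^{n-1}(1+q^i) & \text{if } 0,1\notin M,\\[2mm] \displaystyle\frac{\prod_{i=1}^{n-1}(1+q^i)}{[m_2]_q} & \text{if } 0\notin M \text{ and } 1\in M.\end{cases}$$ (For $M=\emptyset$ the list of parts is the single part $m_1=n$; for $M=\{1\}$ one has $m_2=n$. Empty products are $1$.) -/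

import Mathlib

namespace TypeD

/-- The set `[-n, n] \ {0}`. -/
abbrev Pt (n : ℕ) : Type := {x : ℤ // x ≠ 0 ∧ -(n : ℤ) ≤ x ∧ x ≤ n}

instance (n : ℕ) : Finite (Pt n) :=
  Finite.of_injective
    (fun x : Pt n => (⟨x.1, Finset.mem_Icc.2 x.2.2⟩ : Finset.Icc (-(n : ℤ)) n))
    (fun _ _ h => Subtype.ext (congrArg (fun z => z.1) h))

noncomputable instance (n : ℕ) : Fintype (Pt n) := Fintype.ofFinite _

/-- The negation `x ↦ -x` on `[-n, n] \ {0}`. -/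
instance (n : ℕ) : InvolutiveNeg (Pt n) where
  neg x := ⟨-x.1, by have := x.2; omega⟩
  neg_neg x := Subtype.ext (neg_neg x.1)

@[simp] theorem coe_neg {n : ℕ} (x : Pt n) : ((-x : Pt n) : ℤ) = -(x : ℤ) := rfl

/-- The element `i` of `[n]`, seen in `[-n, n] \ {0}`. -/
def pt {n : ℕ} (i : ℕ) (h : 1 ≤ i ∧ i ≤ n) : Pt n := ⟨i, by omega⟩

/-- The group `B_n` of signed permutations: the bijections `β` of `[-n, n] \ {0}` with
`β(-x) = -β(x)`, under composition. -/
def B (n : ℕ) : Subgroup (Equiv.Perm (Pt n)) where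
  carrier := {β | ∀ x, β (-x) = -β x}
  one_mem' := fun _ => rfl
  mul_mem' := by
    intro a b ha hb x
    simp only [Set.mem_ofPred_eq] at ha hb
    simp [Equiv.Perm.mul_apply, ha, hb]
  inv_mem' := by
    intro a ha x
    simp only [Set.mem_ofPred_eq] at ha
    rw [Equiv.Perm.inv_eq_iff_eq, ha]
    simp

/-- `N₁(β)`: the number of `i ∈ [n]` with `β(i) < 0`. -/
noncomputable def N₁ {n : ℕ} (β : Equiv.Perm (Pt n)) : ℕ :=
  (Finset.univ.filter fun x : Pt n => 0 < x.1 ∧ (β x).1 < 0).card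

theorem N₁_one {n : ℕ} : N₁ (1 : Equiv.Perm (Pt n)) = 0 := by
  rw [N₁, Finset.card_eq_zero, Finset.filter_eq_empty_iff]
  intro x _ h
  rw [Equiv.Perm.one_apply] at h
  omega

theorem sign_mul_sign {n : ℕ} (x : Pt n) : Int.sign x.1 * Int.sign x.1 = 1 := by
  rcases lt_or_gt_of_ne x.2.1 with h | h
  · simp [Int.sign_eq_neg_one_of_neg h]
  · simp [Int.sign_eq_one_of_pos h]

/-- An odd bijection permutes the absolute values, so it preserves the product over `[n]` of an
even function. -/
theorem prod_even_comp {n : ℕ} (f : Pt n → ℤ) (hf : ∀ x, f (-x) = f x)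
    (β : Equiv.Perm (Pt n)) (hβ : β ∈ B n) :
    ∏ x : Pt n with 0 < x.1, f (β x) = ∏ x : Pt n with 0 < x.1, f x := by
  have hβ' : ∀ x, β (-x) = -β x := hβ
  refine Finset.prod_bij (fun x _ => if 0 < (β x).1 then β x else -β x) ?_ ?_ ?_ ?_
  · intro x _
    have := (β x).2.1
    split_ifs with h
    · simpa using h
    · simp only [Finset.mem_filter, Finset.mem_univ, true_and, coe_neg]
      omega
  · intro x hx y hy h
    simp only [Finset.mem_filter, Finset.mem_univ, true_and] at hx hy
    split_ifs at h with h1 h2 h2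
    · exact β.injective h
    · rw [← hβ'] at h
      have := congrArg Subtype.val (β.injective h)
      simp only [coe_neg] at this
      omega
    · rw [← hβ'] at h
      have := congrArg Subtype.val (β.injective h)
      simp only [coe_neg] at this
      omega
    · exact β.injective (neg_injective h)
  · intro y hy
    simp only [Finset.mem_filter, Finset.mem_univ, true_and] at hy
    obtain ⟨x, rfl⟩ := β.surjective y
    rcases lt_or_gt_of_ne x.2.1 with h | h
    · refine ⟨-x, by simpa using h, ?_⟩
      have h0 : ¬ (0 < (-β x : Pt n).1) := by simp only [coe_neg]; omega
      rw [hβ', if_neg h0, neg_neg]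
    · exact ⟨x, by simpa using h, if_pos hy⟩
  · intro x _
    split_ifs
    · rfl
    · rw [hf]

theorem neg_one_pow_N₁ {n : ℕ} (β : Equiv.Perm (Pt n)) :
    (-1 : ℤ) ^ N₁ β = ∏ x : Pt n with 0 < x.1, Int.sign (β x).1 := by
  have h : ∀ x : Pt n, Int.sign (β x).1 = if (β x).1 < 0 then -1 else 1 := by
    intro x
    split_ifs with h
    · exact Int.sign_eq_neg_one_of_neg h
    · exact Int.sign_eq_one_of_pos (lt_of_le_of_ne (not_lt.1 h) (β x).2.1.symm)
  rw [Finset.prod_congr rfl (fun x _ => h x), Finset.prod_ite]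
  simp [N₁, Finset.filter_filter]

theorem neg_one_pow_N₁_mul {n : ℕ} {β γ : Equiv.Perm (Pt n)} (hβ : β ∈ B n) (hγ : γ ∈ B n) :
    (-1 : ℤ) ^ N₁ (β * γ) = (-1) ^ N₁ β * (-1) ^ N₁ γ := by
  have hβ' : ∀ x, β (-x) = -β x := hβ
  have key := prod_even_comp (fun x => Int.sign (β x).1 * Int.sign x.1)
    (fun x => by simp [hβ', Int.sign_neg]) γ hγ
  have h1 : ∏ x : Pt n with 0 < x.1, Int.sign (β x).1 * Int.sign x.1
      = ∏ x : Pt n with 0 < x.1, Int.sign (β x).1 := by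
    refine Finset.prod_congr rfl fun x hx => ?_
    have hx' : 0 < x.1 := by simpa using hx
    rw [Int.sign_eq_one_of_pos hx', mul_one]
  rw [h1] at key
  rw [neg_one_pow_N₁, neg_one_pow_N₁, neg_one_pow_N₁, ← key, ← Finset.prod_mul_distrib]
  refine Finset.prod_congr rfl fun x _ => ?_
  rw [mul_assoc, sign_mul_sign, mul_one, Equiv.Perm.mul_apply]

/-- The even-signed permutation group `D_n = {γ ∈ B_n | N₁(γ) ≡ 0 mod 2}`. -/
def D (n : ℕ) : Subgroup (Equiv.Perm (Pt n)) where
  carrier := {γ | γ ∈ B n ∧ Even (N₁ γ)}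
  one_mem' := by
    refine ⟨one_mem _, ?_⟩
    have : N₁ (1 : Equiv.Perm (Pt n)) = 0 := N₁_one
    rw [this]
    exact Even.zero
  mul_mem' := by
    rintro a b ⟨ha, ha'⟩ ⟨hb, hb'⟩
    refine ⟨mul_mem ha hb, ?_⟩
    have := neg_one_pow_N₁_mul ha hb
    rw [ha'.neg_one_pow, hb'.neg_one_pow, mul_one] at this
    exact (neg_one_pow_eq_one_iff_even (by norm_num)).1 this
  inv_mem' := by
    rintro a ⟨ha, ha'⟩
    refine ⟨inv_mem ha, ?_⟩
    have := neg_one_pow_N₁_mul ha (inv_mem ha)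
    have h1 : N₁ (1 : Equiv.Perm (Pt n)) = 0 := N₁_one
    rw [mul_inv_cancel, h1, ha'.neg_one_pow, pow_zero, one_mul] at this
    exact (neg_one_pow_eq_one_iff_even (by norm_num)).1 this.symm

noncomputable instance (n : ℕ) : Fintype (D n) := Fintype.ofFinite _

/-- The signed permutation exchanging `a` with `b` and `-a` with `-b` (for `a ≠ ±b`). -/
def swapSigned {n : ℕ} (a b : Pt n) : Equiv.Perm (Pt n) :=
  Equiv.swap a b * Equiv.swap (-a) (-b)

/-- The underlying permutations of the generators: `[1, …, i-1, i+1, i, i+2, …, n]` for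
`1 ≤ i ≤ n - 1`, and `[-2, -1, 3, …, n]` for `i = 0` (which exists only for `2 ≤ n`; the value is
the identity otherwise). -/
def genPerm (n i : ℕ) : Equiv.Perm (Pt n) :=
  if h : 1 ≤ i ∧ i + 1 ≤ n then
    swapSigned (pt i (by omega)) (pt (i + 1) (by omega))
  else if h : i = 0 ∧ 2 ≤ n then
    swapSigned (pt 1 (by omega)) (-pt 2 (by omega))
  else 1

theorem coe_swap {n : ℕ} (a b x : Pt n) :
    ((Equiv.swap a b x : Pt n) : ℤ) =
      if (x : ℤ) = a then (b : ℤ) else if (x : ℤ) = b then (a : ℤ) else x := by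
  simp only [Equiv.swap_apply_def, Subtype.ext_iff]
  split_ifs <;> rfl

theorem swapSigned_mem_B {n : ℕ} (a b : Pt n) : swapSigned a b ∈ B n := by
  intro x
  have ha := a.2
  have hb := b.2
  have hx := x.2
  apply Subtype.ext
  simp only [swapSigned, Equiv.Perm.mul_apply, coe_swap, coe_neg]
  split_ifs <;> omega

theorem genPerm_mem_D (n i : ℕ) : genPerm n i ∈ D n := by
  unfold genPerm
  split_ifs with h h
  · refine ⟨swapSigned_mem_B _ _, ?_⟩
    have : N₁ (swapSigned (pt (n := n) i (by omega)) (pt (i + 1) (by omega))) = 0 := by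
      simp only [N₁, Finset.card_eq_zero, Finset.filter_eq_empty_iff]
      intro x _
      have hx := x.2
      simp only [swapSigned, Equiv.Perm.mul_apply, Equiv.swap_apply_def, Subtype.ext_iff]
      split_ifs <;> simp_all [pt] <;> omega
    rw [this]
    exact Even.zero
  · refine ⟨swapSigned_mem_B _ _, ?_⟩
    have : N₁ (swapSigned (pt (n := n) 1 (by omega)) (-pt 2 (by omega))) = 2 := by
      rw [N₁, Finset.card_eq_two]
      refine ⟨pt 1 (by omega), pt 2 (by omega), by simp [pt], ?_⟩
      ext x
      have hx := x.2
      simp only [Finset.mem_filter, Finset.mem_univ, true_and, Finset.mem_insert,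
        Finset.mem_singleton, swapSigned, Equiv.Perm.mul_apply, Equiv.swap_apply_def,
        Subtype.ext_iff]
      split_ifs <;> simp_all [pt]; omega
    rw [this]
    exact even_two
  · exact one_mem _

/-- The generator `s_i^D` of `D_n`, `0 ≤ i ≤ n - 1`. -/
def gen (n i : ℕ) : D n := ⟨genPerm n i, genPerm_mem_D n i⟩

/-- The length `ℓ_D(γ)`: the least length of a word in `s_0^D, …, s_{n-1}^D` with product `γ`. -/
noncomputable def length {n : ℕ} (γ : D n) : ℕ :=
  sInf {k | ∃ w : List (Fin n), w.length = k ∧ (w.map fun i => gen n i).prod = γ}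

/-- The right descent set `Des_D(γ)`, as a set of indices in `[0, n-1]`. -/
noncomputable def DesD {n : ℕ} (γ : D n) : Finset ℕ :=
  (Finset.range n).filter fun i => length (γ * gen n i) < length γ

/-- The entry `γ(i)` of the window of `γ`, for `i ∈ [n]` (zero for other `i`). -/
def window {n : ℕ} (γ : D n) (i : ℕ) : ℤ :=
  if h : 1 ≤ i ∧ i ≤ n then (γ.1 (pt i h)).1 else 0

/-- The usual descent set `Des(γ) = {i ∈ [n-1] | γ(i) > γ(i+1)}`. -/
def Des {n : ℕ} (γ : D n) : Finset ℕ :=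
  (Finset.Ico 1 n).filter fun i => window γ (i + 1) < window γ i

/-- The multiset `DDes(γ) = Des(γ) ⊎ {-γ(i) - 1 | γ(i) < 0} \ {0}`. -/
def DDes {n : ℕ} (γ : D n) : Multiset ℕ :=
  (Des γ).val +
    ((((Finset.Icc 1 n).filter fun i => window γ i < 0).val.map
      fun i => (-window γ i - 1).toNat).filter fun j => j ≠ 0)

/-- `dmaj(γ)`, the sum of the elements of `DDes(γ)`. -/
def dmaj {n : ℕ} (γ : D n) : ℕ := (DDes γ).sum

/-- The descent class `D(M) = {γ ∈ D_n | Des_D(γ⁻¹) ⊆ M}`. -/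
noncomputable def descentClass (n : ℕ) (M : Finset ℕ) : Finset (D n) :=
  Finset.univ.filter fun γ => DesD γ⁻¹ ⊆ M

section QAnalogs

variable {K : Type*} [Field K]

/-- `[k]_q = 1 + q + ⋯ + q^(k-1)`. -/
def qInt (q : K) (k : ℕ) : K := ∑ i ∈ Finset.range k, q ^ i

/-- `[k]_q! = [1]_q [2]_q ⋯ [k]_q`. -/
def qFactorial (q : K) (k : ℕ) : K := ∏ i ∈ Finset.Icc 1 k, qInt q i

/-- The `q`-multinomial coefficient `[n]_q! / ([c_1]_q! [c_2]_q! ⋯)`. -/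
def qMultinomial (q : K) (n : ℕ) (c : List ℕ) : K :=
  qFactorial q n / (c.map (qFactorial q)).prod

end QAnalogs

/-- The list `m_1, …, m_t, m_{t+1}` where `M = {m_1 < ⋯ < m_t}` and `m_{t+1} = n`. -/
def elems (n : ℕ) (M : Finset ℕ) : List ℕ := M.sort ++ [n]

/-- The element `m_i`, for `1 ≤ i ≤ t + 1`, with `m_{t+1} = n`. -/
def elem (n : ℕ) (M : Finset ℕ) (i : ℕ) : ℕ := (elems n M).getD (i - 1) n

/-- The list `m_1, m_2 - m_1, …, n - m_t`. -/
def parts (n : ℕ) (M : Finset ℕ) : List ℕ :=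
  List.zipWith (fun a b => b - a) (0 :: elems n M) (elems n M)

end TypeD

/-! Both statistics have the form (word statistic of the window) + (sum of `a - 1` over the letters
`a` that carry a minus sign). The word statistic is the major index for `dmaj` (`dmaj_eq`) and the
inversion number for the length (`length_eq`). The latter comes from counting positive roots made
negative; the same count reads `Des_D` off the window (`mem_DesD`).

Drop the parity condition and the condition at `0`, and consider all `γ ∈ B_n` whose inverse has no
descent in `[n-1] \ M`. The set `M` cuts `[n]` into blocks. In each block the letters with a minus
sign form an initial segment, and once the set `N` of negative letters is fixed, the windows are
exactly the words in which the negative and the positive letters of each block increase from left to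
right. MacMahon's theorem, in the form `sum_words_revMaj` and `sum_words_revInv`, gives the same
`q`-multinomial coefficient for both word statistics. Summing over `N` factors over the blocks, and
the `q`-binomial theorem evaluates each factor. This gives `sum_signedStat`, with a free weight `X
s` for each negative letter of the block that begins after `s`.

The three cases are specializations of that formula. Taking `X = 1` and `X = -1` separates the
parities: the second sum vanishes because of the factor `1 - q^0` at the letter `1`, so the even and
the odd elements have equal sums. This settles `0 ∈ M`. For `0 ∉ M` the tool is the change of sign
of the letter `±1`: it preserves both statistics, since no letter lies between `-1` and `1` and the
letter `1` has weight `0`, but it changes the parity. It carries the condition `γ⁻¹(1) + γ⁻¹(2) > 0`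
to `γ⁻¹(1) < γ⁻¹(2)`. If `1 ∈ M`, the class becomes the odd elements for `M \ {1}`. If `1 ∉ M`, it
can be traded for the elements in which the letter `1` is positive, which are selected by the weight
`X = 0` on the first block. -/

namespace TypeD

/-! ### Length and descents of `D_n` through root inversions -/

/-- The entry `γ(i)` of the window of a permutation of `[-n, n] \ {0}` (zero for `i ∉ [n]`). -/
def win {n : ℕ} (γ : Equiv.Perm (Pt n)) (i : ℕ) : ℤ :=
  if h : 1 ≤ i ∧ i ≤ n then (γ (pt i h)).1 else 0

theorem win_of_mem {n : ℕ} (γ : Equiv.Perm (Pt n)) {i : ℕ} (h : 1 ≤ i ∧ i ≤ n) :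
    win γ i = (γ (pt i h)).1 := dif_pos h

@[simp] theorem coe_pt {n i : ℕ} (h : 1 ≤ i ∧ i ≤ n) : ((pt i h : Pt n) : ℤ) = i := rfl

/-- The pairs of positive roots of type `D` (each root occurring twice) that `γ` makes negative. -/
noncomputable def rootInv {n : ℕ} (γ : Equiv.Perm (Pt n)) : Finset (Pt n × Pt n) :=
  Finset.univ.filter fun p => p.1.1 < p.2.1 ∧ p.1.1 + p.2.1 ≠ 0 ∧ (γ p.2).1 < (γ p.1).1

theorem mem_rootInv {n : ℕ} {γ : Equiv.Perm (Pt n)} {x y : Pt n} :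
    (x, y) ∈ rootInv γ ↔ x.1 < y.1 ∧ x.1 + y.1 ≠ 0 ∧ (γ y).1 < (γ x).1 := by
  simp [rootInv]

/-- `s` is the reflection in the simple root given by the pairs `(u, v)` and `(-v, -u)`. -/
structure IsSimpleRefl {n : ℕ} (s : Equiv.Perm (Pt n)) (u v : Pt n) : Prop where
  lt : u.1 < v.1
  add_ne : u.1 + v.1 ≠ 0
  mem : s ∈ B n
  invol : ∀ x, s (s x) = x
  apply_left : s u = v
  lt_of_lt : ∀ x y : Pt n, x.1 < y.1 → x.1 + y.1 ≠ 0 → ¬(x = u ∧ y = v) →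
    ¬(x = -v ∧ y = -u) → (s x).1 < (s y).1

theorem ne_of_B {n : ℕ} {γ : Equiv.Perm (Pt n)} (hγ : γ ∈ B n) {x y : Pt n}
    (h : x.1 + y.1 ≠ 0) : (γ x).1 + (γ y).1 ≠ 0 := by
  have hγ' : ∀ x, γ (-x) = -γ x := hγ
  intro h'
  have : γ x = γ (-y) := by
    rw [hγ']; apply Subtype.ext; rw [coe_neg]; omega
  have := congrArg Subtype.val (γ.injective this)
  rw [coe_neg] at this
  omega

/-- A simple reflection preserves the order of every pair except `(u, v)` and `(-v, -u)`, which it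
reverses. Hence `s × s` transports the old inversions to the new ones, and exactly these two pairs
are added. -/
theorem IsSimpleRefl.card_rootInv {n : ℕ} {s : Equiv.Perm (Pt n)} {u v : Pt n}
    (hs : IsSimpleRefl s u v) {γ : Equiv.Perm (Pt n)} (hγ : γ ∈ B n)
    (h : (γ u).1 < (γ v).1) : (rootInv (γ * s)).card = (rootInv γ).card + 2 := by
  have hγ' : ∀ x, γ (-x) = -γ x := hγ
  have hsm : ∀ x, s (-x) = -s x := hs.mem
  have hv : s v = u := by rw [← hs.apply_left, hs.invol]
  have hlt := hs.lt
  have hadd := hs.add_ne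
  have key : rootInv (γ * s) = insert (u, v) (insert (-v, -u)
      ((rootInv γ).map (s.prodCongr s).toEmbedding)) := by
    ext ⟨x, y⟩
    simp only [Finset.mem_insert, Finset.mem_map_equiv, mem_rootInv, Prod.mk.injEq,
      Equiv.Perm.mul_apply, Equiv.prodCongr_symm, Equiv.prodCongr_apply, Prod.map]
    have hsymm : ∀ x, s.symm x = s x := fun x => by
      rw [Equiv.symm_apply_eq, hs.invol]
    rw [hsymm, hsymm]
    by_cases h1 : x = u ∧ y = v
    · obtain ⟨rfl, rfl⟩ := h1
      simp [hs.apply_left, hv, h, hlt, hadd]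
    by_cases h2 : x = -v ∧ y = -u
    · obtain ⟨rfl, rfl⟩ := h2
      simp only [hsm, hs.apply_left, hv, hγ', coe_neg]
      simp only [and_self, true_or, or_true, iff_true]
      omega
    simp only [h1, h2, false_or]
    by_cases hxy : x.1 + y.1 = 0
    · have : y = -x := Subtype.ext (by rw [coe_neg]; omega)
      subst this
      simp [hsm]
    have hxy' : (s x).1 + (s y).1 ≠ 0 := ne_of_B hs.mem hxy
    simp only [hxy, hxy', ne_eq, not_false_eq_true, true_and]
    constructor
    · rintro ⟨a, b⟩
      exact ⟨hs.lt_of_lt x y a hxy h1 h2, b⟩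
    · rintro ⟨a, b⟩
      refine ⟨?_, b⟩
      by_cases h3 : s x = u ∧ s y = v
      · rw [h3.1, h3.2] at b; omega
      by_cases h4 : s x = -v ∧ s y = -u
      · rw [h4.1, h4.2, hγ', hγ', coe_neg, coe_neg] at b; omega
      have := hs.lt_of_lt _ _ a hxy' h3 h4
      rwa [hs.invol, hs.invol] at this
  have n1 : (-v, -u) ∉ (rootInv γ).map (s.prodCongr s).toEmbedding := by
    simp only [Finset.mem_map_equiv, mem_rootInv, Equiv.prodCongr_symm, Equiv.prodCongr_apply,
      Prod.map]
    rintro ⟨h1, -⟩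
    have h2 : s.symm (-v) = -u := by rw [Equiv.symm_apply_eq, hsm, hs.apply_left]
    have h3 : s.symm (-u) = -v := by rw [Equiv.symm_apply_eq, hsm, hv]
    rw [h2, h3, coe_neg, coe_neg] at h1
    omega
  have n2 : (u, v) ∉ insert (-v, -u) ((rootInv γ).map (s.prodCongr s).toEmbedding) := by
    simp only [Finset.mem_insert, Finset.mem_map_equiv, mem_rootInv, Equiv.prodCongr_symm,
      Equiv.prodCongr_apply, Prod.map, not_or, Prod.mk.injEq]
    constructor
    · rintro ⟨h1, -⟩
      have := congrArg Subtype.val h1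
      rw [coe_neg] at this
      omega
    · rintro ⟨h1, -⟩
      have h2 : s.symm v = u := by rw [Equiv.symm_apply_eq, hs.apply_left]
      have h3 : s.symm u = v := by rw [Equiv.symm_apply_eq, hv]
      rw [h2, h3] at h1
      omega
  rw [key, Finset.card_insert_of_notMem n2, Finset.card_insert_of_notMem n1, Finset.card_map]

theorem IsSimpleRefl.card_rootInv_of_gt {n : ℕ} {s : Equiv.Perm (Pt n)} {u v : Pt n}
    (hs : IsSimpleRefl s u v) {γ : Equiv.Perm (Pt n)} (hγ : γ ∈ B n)
    (h : (γ v).1 < (γ u).1) : (rootInv γ).card = (rootInv (γ * s)).card + 2 := by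
  have hv : s v = u := by rw [← hs.apply_left, hs.invol]
  have hss : s * s = 1 := Equiv.ext hs.invol
  have := hs.card_rootInv (γ := γ * s) (mul_mem hγ hs.mem)
    (by rwa [Equiv.Perm.mul_apply, Equiv.Perm.mul_apply, hs.apply_left, hv])
  rwa [mul_assoc, hss, mul_one] at this

/-- The descent condition of type `D` at `i`, read off from the window. -/
def IsDesc {n : ℕ} (γ : Equiv.Perm (Pt n)) (i : ℕ) : Prop :=
  -- For `n = 1` the generator of index `0` is the identity and `win γ 2` is the default `0`; the
  -- guard keeps `[-1]` from having a descent there.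
  if i = 0 then 2 ≤ n ∧ win γ 1 + win γ 2 < 0 else win γ (i + 1) < win γ i

theorem exists_isSimpleRefl {n i : ℕ} (hi : i < n) (h2 : 2 ≤ n) :
    ∃ u v : Pt n, IsSimpleRefl (genPerm n i) u v ∧
      ∀ γ ∈ B n, (IsDesc γ i ↔ (γ v).1 < (γ u).1) := by
  rcases Nat.eq_zero_or_pos i with rfl | hpos
  · have hg : genPerm n 0 = swapSigned (pt 1 (by omega)) (-pt 2 (by omega)) := by
      simp [genPerm, h2]
    -- The simple root of index `0` is the pair `(-2, 1)`: `γ(1) < γ(-2)` says `γ(1) + γ(2) < 0`.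
    refine ⟨-pt 2 (by omega), pt 1 (by omega), ⟨by simp, by simp, (genPerm_mem_D n 0).1,
      fun x => ?_, ?_, fun x y h1 h2 h3 h4 => ?_⟩, fun γ hγ => ?_⟩
    · apply Subtype.ext
      simp only [hg, swapSigned, Equiv.Perm.mul_apply, coe_swap, coe_neg, coe_pt]
      split_ifs <;> omega
    · apply Subtype.ext
      simp [hg, swapSigned, coe_swap]
    · have hx := x.2
      have hy := y.2
      simp only [Subtype.ext_iff, coe_neg, coe_pt] at h3 h4
      simp only [hg, swapSigned, Equiv.Perm.mul_apply, coe_swap, coe_neg, coe_pt]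
      split_ifs <;> omega
    · have hγ' : ∀ x, γ (-x) = -γ x := hγ
      rw [IsDesc, if_pos rfl, win_of_mem _ (by omega), win_of_mem _ (by omega), hγ', coe_neg]
      omega
  · have hg : genPerm n i = swapSigned (pt i (by omega)) (pt (i + 1) (by omega)) := by
      rw [genPerm, dif_pos (by omega)]
    refine ⟨pt i (by omega), pt (i + 1) (by omega), ⟨by simp, by simp; omega,
      (genPerm_mem_D n i).1, fun x => ?_, ?_, fun x y h1 h2 h3 h4 => ?_⟩, fun γ hγ => ?_⟩
    · apply Subtype.ext
      simp only [hg, swapSigned, Equiv.Perm.mul_apply, coe_swap, coe_neg, coe_pt]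
      split_ifs <;> omega
    · apply Subtype.ext
      simp only [hg, swapSigned, Equiv.Perm.mul_apply, coe_swap, coe_neg, coe_pt]
      split_ifs <;> omega
    · have hx := x.2
      have hy := y.2
      simp only [Subtype.ext_iff, coe_neg, coe_pt] at h3 h4
      simp only [hg, swapSigned, Equiv.Perm.mul_apply, coe_swap, coe_neg, coe_pt]
      split_ifs <;> omega
    · rw [IsDesc, if_neg (by omega), win_of_mem _ (by omega), win_of_mem _ (by omega)]

theorem genPerm_of_lt_two {n : ℕ} (h : n < 2) (i : ℕ) : genPerm n i = 1 := by
  rw [genPerm, dif_neg (by omega), dif_neg (by omega)]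

/-- A finite linear order has no order automorphism but the identity. -/
theorem eq_one_of_monotone {n : ℕ} {γ : Equiv.Perm (Pt n)}
    (h : ∀ x y : Pt n, x.1 < y.1 → (γ x).1 < (γ y).1) : γ = 1 := by
  have hm : StrictMono γ := fun x y hxy => h x y hxy
  have : Finite (Pt n) := inferInstance
  let e : Pt n ≃o Pt n := hm.orderIsoOfSurjective γ γ.surjective
  have he : e = OrderIso.refl _ := Subsingleton.elim _ _
  ext1 x
  exact congrArg (fun f : Pt n ≃o Pt n => f x) he

theorem win_lt_win {n : ℕ} {γ : Equiv.Perm (Pt n)}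
    (h : ∀ i, 1 ≤ i → i < n → win γ i < win γ (i + 1)) {i j : ℕ} (hi : 1 ≤ i) (hij : i < j)
    (hj : j ≤ n) : win γ i < win γ j := by
  induction j, hij using Nat.le_induction with
  | base => exact h i hi (by omega)
  | succ k hk ih => exact (ih (by omega)).trans (h k (by omega) (by omega))

theorem win_natAbs {n : ℕ} {γ : Equiv.Perm (Pt n)} (hγ : γ ∈ B n) (x : Pt n) :
    (γ x).1 = Int.sign x.1 * win γ x.1.natAbs := by
  have hγ' : ∀ x, γ (-x) = -γ x := hγ
  have hx := x.2
  rw [win_of_mem γ (by omega)]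
  rcases lt_or_gt_of_ne x.2.1 with h | h
  · rw [Int.sign_eq_neg_one_of_neg h]
    have : x = -pt x.1.natAbs (by omega) := Subtype.ext (by rw [coe_neg, coe_pt]; omega)
    conv_lhs => rw [this, hγ', coe_neg]
    ring
  · rw [Int.sign_eq_one_of_pos h, one_mul]
    congr 2
    exact Subtype.ext (by rw [coe_pt]; omega)

/-- The window increases, and the condition at `0` allows at most its first entry to be negative. A
single negative entry contradicts evenness, so the window is positive and `γ` is monotone. -/
theorem eq_one_of_not_isDesc {n : ℕ} {γ : Equiv.Perm (Pt n)} (hγ : γ ∈ D n)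
    (h : ∀ i < n, ¬ IsDesc γ i) : γ = 1 := by
  have hγ' : ∀ x, γ (-x) = -γ x := hγ.1
  rcases Nat.eq_zero_or_pos n with rfl | hn
  · ext x; have := x.2; omega
  have hstep : ∀ i, 1 ≤ i → i < n → win γ i < win γ (i + 1) := by
    intro i h1 h2
    have := h i h2
    rw [IsDesc, if_neg (by omega), not_lt] at this
    refine lt_of_le_of_ne this fun he => ?_
    rw [win_of_mem _ (by omega), win_of_mem _ (by omega)] at he
    have := congrArg Subtype.val (γ.injective (Subtype.ext he))
    simp at this
  have hpos : 0 < win γ 1 := by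
    by_contra hneg
    have hne : win γ 1 ≠ 0 := by
      rw [win_of_mem _ (by omega)]; exact (γ _).2.1
    have hbig : ∀ j, 1 < j → j ≤ n → 0 < win γ j := by
      intro j h1 h2
      have h3 := h 0 hn
      rw [IsDesc, if_pos rfl] at h3
      have h4 : win γ 2 ≤ win γ j := by
        rcases eq_or_lt_of_le (show 2 ≤ j from h1) with rfl | h5
        · exact le_rfl
        · exact (win_lt_win hstep (by omega) h5 h2).le
      have : ¬ (win γ 1 + win γ 2 < 0) := fun h5 => h3 ⟨by omega, h5⟩
      omega
    have hN : N₁ γ = 1 := by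
      rw [N₁, Finset.card_eq_one]
      refine ⟨pt 1 (by omega), ?_⟩
      ext x
      have hx := x.2
      simp only [Finset.mem_filter, Finset.mem_univ, true_and, Finset.mem_singleton,
        Subtype.ext_iff, coe_pt]
      constructor
      · rintro ⟨h1, h2⟩
        rw [win_natAbs hγ.1, Int.sign_eq_one_of_pos h1, one_mul] at h2
        by_contra h3
        have := hbig x.1.natAbs (by omega) (by omega)
        omega
      · intro h1
        refine ⟨by omega, ?_⟩
        rw [win_natAbs hγ.1, h1]
        simp
        omega
    have := hγ.2
    rw [hN] at this
    exact absurd this (by decide)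
  have hpos' : ∀ j, 1 ≤ j → j ≤ n → 0 < win γ j := by
    intro j h1 h2
    rcases eq_or_lt_of_le h1 with rfl | h3
    · exact hpos
    · exact hpos.trans (win_lt_win hstep le_rfl h3 h2)
  refine eq_one_of_monotone fun x y hxy => ?_
  have hx := x.2
  have hy := y.2
  rw [win_natAbs hγ.1, win_natAbs hγ.1]
  have hx' := hpos' x.1.natAbs (by omega) (by omega)
  have hy' := hpos' y.1.natAbs (by omega) (by omega)
  rcases lt_or_gt_of_ne x.2.1 with h1 | h1 <;> rcases lt_or_gt_of_ne y.2.1 with h2 | h2 <;>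
    simp only [Int.sign_eq_neg_one_of_neg, Int.sign_eq_one_of_pos, h1, h2]
  · have := win_lt_win hstep (i := y.1.natAbs) (j := x.1.natAbs) (by omega) (by omega) (by omega)
    omega
  · omega
  · omega
  · have := win_lt_win hstep (i := x.1.natAbs) (j := y.1.natAbs) (by omega) (by omega) (by omega)
    omega

theorem card_rootInv_one {n : ℕ} : (rootInv (1 : Equiv.Perm (Pt n))).card = 0 := by
  rw [Finset.card_eq_zero, rootInv, Finset.filter_eq_empty_iff]
  rintro ⟨x, y⟩ - ⟨h1, -, h2⟩
  exact lt_asymm h1 h2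

theorem card_rootInv_mul_gen_le {n : ℕ} {γ : Equiv.Perm (Pt n)} (hγ : γ ∈ B n) (i : Fin n) :
    (rootInv (γ * genPerm n i)).card ≤ (rootInv γ).card + 2 := by
  rcases lt_or_ge n 2 with h | h
  · rw [genPerm_of_lt_two h, mul_one]; omega
  obtain ⟨u, v, hs, -⟩ := exists_isSimpleRefl i.2 h
  rcases lt_trichotomy (γ u).1 (γ v).1 with h1 | h1 | h1
  · rw [hs.card_rootInv hγ h1]
  · have := congrArg Subtype.val (γ.injective (Subtype.ext h1))
    have := hs.lt
    omega
  · have := hs.card_rootInv_of_gt hγ h1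
    omega

theorem card_rootInv_word_le {n : ℕ} (w : List (Fin n)) :
    (rootInv (w.map fun i : Fin n => gen n i).prod.1).card ≤ 2 * w.length := by
  induction w using List.reverseRecOn with
  | nil => simp [card_rootInv_one]
  | append_singleton w i ih =>
    have := card_rootInv_mul_gen_le (w.map fun i : Fin n => gen n i).prod.2.1 i
    simp only [List.map_append, List.map_cons, List.map_nil, List.prod_append, List.prod_singleton,
      List.length_append, List.length_singleton, Subgroup.coe_mul, gen] at this ih ⊢
    omega

/-- Multiplying by the generator at a descent removes two inversions. Only the identity has no
descent, so the process ends there with a word of half as many letters as there were inversions. -/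
theorem exists_word {n : ℕ} (k : ℕ) (γ : D n) (hk : (rootInv γ.1).card ≤ k) :
    ∃ w : List (Fin n), (rootInv γ.1).card = 2 * w.length ∧
      (w.map fun i : Fin n => gen n i).prod = γ := by
  induction k using Nat.strong_induction_on generalizing γ with
  | _ k ih =>
    by_cases h : ∀ i < n, ¬ IsDesc γ.1 i
    · have : γ = 1 := Subtype.ext (eq_one_of_not_isDesc γ.2 h)
      subst this
      exact ⟨[], by simp [card_rootInv_one], rfl⟩
    push Not at h
    obtain ⟨i, hi, hd⟩ := h
    have h2 : 2 ≤ n := by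
      by_contra hlt
      have : i = 0 := by omega
      rw [IsDesc, if_pos this] at hd
      exact hlt hd.1
    obtain ⟨u, v, hs, hiff⟩ := exists_isSimpleRefl hi h2
    have hc := hs.card_rootInv_of_gt γ.2.1 ((hiff _ γ.2.1).1 hd)
    have hc' : (rootInv (γ * gen n i).1).card + 2 = (rootInv γ.1).card := hc.symm
    obtain ⟨w, hw, hw'⟩ := ih (k - 2) (by omega) (γ * gen n i) (by omega)
    refine ⟨w ++ [⟨i, hi⟩], by simp; omega, ?_⟩
    have hss : gen n i * gen n i = 1 := Subtype.ext (Equiv.ext hs.invol)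
    simp [hw', mul_assoc, hss]

/-- The two sides differ although they look alike: on the left, as in `length`, the bound index is a
natural number and the whole list is coerced to `List ℕ`; on the right the map is over `Fin n`. -/
theorem word_prod_eq {n : ℕ} (w : List (Fin n)) :
    (w.map fun i => gen n i).prod = (w.map fun i : Fin n => gen n i).prod := by
  have : (do let a ← w; pure (a : ℕ) : List ℕ) = w.map fun i : Fin n => (i : ℕ) := by
    simp [← List.map_eq_flatMap]
  rw [this, List.map_map]
  rfl

theorem two_mul_length {n : ℕ} (γ : D n) : 2 * length γ = (rootInv γ.1).card := by
  obtain ⟨w, hw, hw'⟩ := exists_word _ γ le_rfl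
  have hmem : w.length ∈ {k | ∃ w : List (Fin n), w.length = k ∧
      (w.map fun i => gen n i).prod = γ} := ⟨w, rfl, (word_prod_eq w).trans hw'⟩
  have h1 : length γ ≤ w.length := Nat.sInf_le hmem
  obtain ⟨w', h2, h3⟩ := Nat.sInf_mem ⟨_, hmem⟩
  have h4 := card_rootInv_word_le w'
  rw [← word_prod_eq, h3, h2] at h4
  have : length γ = sInf {k | ∃ w : List (Fin n), w.length = k ∧
      (w.map fun i => gen n i).prod = γ} := rfl
  omega

theorem mem_DesD {n : ℕ} (γ : D n) (i : ℕ) : i ∈ DesD γ ↔ i < n ∧ IsDesc γ.1 i := by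
  rw [DesD, Finset.mem_filter, Finset.mem_range]
  refine and_congr_right fun hi => ?_
  have e1 := two_mul_length γ
  have e2 := two_mul_length (γ * gen n i)
  have e3 : (γ * gen n i).1 = γ.1 * genPerm n i := rfl
  rw [e3] at e2
  rcases lt_or_ge n 2 with h | h
  · rw [genPerm_of_lt_two h, mul_one] at e2
    have h0 : i = 0 := by omega
    rw [IsDesc, if_pos h0]
    omega
  obtain ⟨u, v, hs, hiff⟩ := exists_isSimpleRefl hi h
  rw [hiff _ γ.2.1]
  rcases lt_trichotomy (γ.1 u).1 (γ.1 v).1 with h1 | h1 | h1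
  · have := hs.card_rootInv γ.2.1 h1
    omega
  · have := congrArg Subtype.val (γ.1.injective (Subtype.ext h1))
    have := hs.lt
    omega
  · have := hs.card_rootInv_of_gt γ.2.1 h1
    omega

/-! ### MacMahon's theorem for words with labelled letters -/

section Words

variable {K : Type*} [Field K]

theorem qInt_succ (q : K) (k : ℕ) : qInt q (k + 1) = qInt q k + q ^ k := Finset.sum_range_succ _ _

theorem qInt_add (q : K) (k l : ℕ) : qInt q (k + l) = qInt q k + q ^ k * qInt q l := by
  simp [qInt, Finset.sum_range_add, Finset.mul_sum, pow_add]

theorem qFactorial_zero (q : K) : qFactorial q 0 = 1 := by simp [qFactorial]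

theorem qFactorial_succ (q : K) (k : ℕ) :
    qFactorial q (k + 1) = qFactorial q k * qInt q (k + 1) := by
  rw [qFactorial, Finset.prod_Icc_succ_top (by omega), ← qFactorial]

theorem qFactorial_ne_zero {q : K} (hq : ∀ k, 1 ≤ k → qInt q k ≠ 0) (k : ℕ) :
    qFactorial q k ≠ 0 :=
  Finset.prod_ne_zero_iff.2 fun i hi => hq i (Finset.mem_Icc.1 hi).1

/-- The number of elements of `A` that exceed `x`. -/
def cardGT (A : Finset ℤ) (x : ℤ) : ℕ := (A.filter fun y => x < y).card

/-- The ranks `cardGT A z` take each value below `A.card` exactly once. -/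
theorem sum_pow_cardGT (q : K) (A : Finset ℤ) : ∑ z ∈ A, q ^ cardGT A z = qInt q A.card := by
  induction A using Finset.induction_on_min with
  | empty => simp [qInt]
  | insert a s ha ih =>
    have hna : a ∉ s := fun h => lt_irrefl _ (ha a h)
    rw [Finset.sum_insert hna, Finset.card_insert_of_notMem hna, qInt_succ, ← ih, add_comm]
    congr 1
    · refine Finset.sum_congr rfl fun z hz => ?_
      rw [cardGT, cardGT, Finset.filter_insert, if_neg (ha z hz).not_gt]
    · rw [cardGT, Finset.filter_insert, if_neg (lt_irrefl a), Finset.filter_true_of_mem ha]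

/-- Raising the ranks of the letters above `x` by `#A` shifts the range of the ranks. -/
theorem sum_pow_cardGT_shift (q : K) (A : Finset ℤ) (x : ℤ) :
    ∑ z ∈ A, q ^ ((if x < z then A.card else 0) + cardGT A z) =
      q ^ cardGT A x * qInt q A.card := by
  have hc : (A.filter fun z => ¬ x < z).card + cardGT A x = A.card := by
    rw [add_comm]
    exact Finset.card_filter_add_card_filter_not (fun z => x < z)
  -- With `c = cardGT A x`, the letters above `x` have ranks `0, …, c - 1`, raised to `#A, …, #A + c
  -- - 1`; the others keep the ranks `c, …, #A - 1`. Together these are the `#A` consecutive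
  -- exponents from `c` on.
  rw [← Finset.sum_filter_add_sum_filter_not A (fun z => x < z)]
  have h1 : ∑ z ∈ A with x < z, q ^ ((if x < z then A.card else 0) + cardGT A z) =
      q ^ A.card * qInt q (cardGT A x) := by
    rw [cardGT, ← sum_pow_cardGT, Finset.mul_sum]
    refine Finset.sum_congr rfl fun z hz => ?_
    have hz' := (Finset.mem_filter.1 hz).2
    rw [if_pos hz', pow_add, cardGT, cardGT, Finset.filter_filter]
    congr 3
    refine Finset.filter_congr fun y _ => ?_
    constructor
    · exact fun h => ⟨hz'.trans h, h⟩
    · exact fun h => h.2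
  have h2 : ∑ z ∈ A with ¬ x < z, q ^ ((if x < z then A.card else 0) + cardGT A z) =
      q ^ cardGT A x * qInt q (A.filter fun z => ¬ x < z).card := by
    rw [← sum_pow_cardGT, Finset.mul_sum]
    refine Finset.sum_congr rfl fun z hz => ?_
    have hz' := (Finset.mem_filter.1 hz).2
    rw [if_neg hz', zero_add, ← pow_add]
    congr 1
    rw [cardGT, cardGT, cardGT, Finset.filter_filter, ← Finset.card_union_of_disjoint]
    · congr 1
      ext y
      simp only [Finset.mem_filter, Finset.mem_union]
      constructor
      · rintro ⟨h3, h4⟩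
        by_cases h5 : x < y
        · exact Or.inl ⟨h3, h5⟩
        · exact Or.inr ⟨h3, h5, h4⟩
      · rintro (⟨h3, h4⟩ | ⟨h3, h4, h5⟩)
        · exact ⟨h3, by omega⟩
        · exact ⟨h3, h5⟩
    · rw [Finset.disjoint_filter]
      exact fun y _ h3 h4 => h4.1 h3
  rw [h1, h2]
  nth_rewrite 1 [← hc]
  rw [← hc, pow_add, qInt_add]
  ring

/-- The words, read from right to left, that arrange the alphabet `A` in such a way that the
letters with equal labels increase from left to right. -/
noncomputable def words (β : ℤ → ℤ) (A : Finset ℤ) : Finset (List ℤ) :=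
  (⟨Multiset.lists A.val, Multiset.lists_nodup_finset A⟩ : Finset (List ℤ)).filter fun l =>
    l.Pairwise fun x y => β x = β y → y < x

theorem mem_words {β : ℤ → ℤ} {A : Finset ℤ} {l : List ℤ} :
    l ∈ words β A ↔ (l : Multiset ℤ) = A.val ∧ l.Pairwise fun x y => β x = β y → y < x := by
  rw [words, Finset.mem_filter]
  refine and_congr_left fun _ => ?_
  rw [Finset.mem_mk, Multiset.mem_lists_iff]
  exact eq_comm

/-- The largest letters of their label classes in `A`. -/
def tops (β : ℤ → ℤ) (A : Finset ℤ) : Finset ℤ :=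
  A.filter fun y => ∀ z ∈ A, β z = β y → z ≤ y

/-- The head of the list is the rightmost letter of the word, so it must be the largest letter of
its class; nothing else restricts it. -/
theorem cons_mem_words {β : ℤ → ℤ} {A : Finset ℤ} {x : ℤ} {l : List ℤ} :
    x :: l ∈ words β A ↔ x ∈ tops β A ∧ l ∈ words β (A.erase x) := by
  rw [mem_words, mem_words, List.pairwise_cons, tops, Finset.mem_filter, Finset.erase_val]
  constructor
  · rintro ⟨h1, h2, h3⟩
    have hx : x ∈ A := by
      rw [← Finset.mem_val, ← h1]; simp
    have hl : (l : Multiset ℤ) = A.val.erase x := by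
      rw [← h1]; simp
    refine ⟨⟨hx, fun z hz hzx => ?_⟩, hl, h3⟩
    rcases eq_or_ne z x with rfl | hne
    · exact le_rfl
    · refine (h2 z ?_ hzx.symm).le
      rw [← Finset.mem_val, ← h1] at hz
      simpa [hne] using hz
  · rintro ⟨⟨hx, h1⟩, h2, h3⟩
    refine ⟨?_, fun y hy hxy => ?_, h3⟩
    · rw [← Multiset.cons_coe, h2, Multiset.cons_erase hx]
    · have : y ∈ A.erase x := by
        rw [← Finset.mem_val, Finset.erase_val, ← h2]; simpa using hy
      rw [Finset.mem_erase] at this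
      exact lt_of_le_of_ne (h1 y this.2 hxy.symm) this.1

theorem words_empty (β : ℤ → ℤ) : words β ∅ = {[]} := by
  ext l
  rw [mem_words, Finset.mem_singleton]
  constructor
  · rintro ⟨h, -⟩
    simpa using h
  · rintro rfl
    simp

theorem sum_words {β : ℤ → ℤ} {A : Finset ℤ} (hA : A.Nonempty) (f : List ℤ → K) :
    ∑ l ∈ words β A, f l = ∑ y ∈ tops β A, ∑ l ∈ words β (A.erase y), f (y :: l) := by
  rw [Finset.sum_sigma']
  symm
  refine Finset.sum_bij (fun p _ => p.1 :: p.2) ?_ ?_ ?_ ?_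
  · rintro ⟨y, l⟩ h
    rw [Finset.mem_sigma] at h
    exact cons_mem_words.2 h
  · rintro ⟨y, l⟩ - ⟨y', l'⟩ - h
    simp only [List.cons.injEq] at h
    obtain ⟨rfl, rfl⟩ := h
    rfl
  · rintro (_ | ⟨y, l⟩) h
    · have := (mem_words.1 h).1
      have h0 : A = ∅ := by
        rw [← Finset.val_eq_zero, ← this]; rfl
      exact absurd h0 hA.ne_empty
    · exact ⟨⟨y, l⟩, Finset.mem_sigma.2 (cons_mem_words.1 h), rfl⟩
  · intros; rfl

/-- The product of the `q`-factorials of the sizes of the label classes of `A`. -/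
noncomputable def classFactorial (q : K) (β : ℤ → ℤ) (T A : Finset ℤ) : K :=
  ∏ b ∈ T, qFactorial q (A.filter fun z => β z = b).card

theorem classFactorial_erase (q : K) {β : ℤ → ℤ} {T A : Finset ℤ} {y : ℤ} (hy : y ∈ A)
    (hT : β y ∈ T) : classFactorial q β T A =
      classFactorial q β T (A.erase y) * qInt q (A.filter fun z => β z = β y).card := by
  rw [classFactorial, classFactorial, ← Finset.mul_prod_erase T _ hT,
    ← Finset.mul_prod_erase T _ hT]
  have h1 : ((A.erase y).filter fun z => β z = β y).card + 1 =
      (A.filter fun z => β z = β y).card := by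
    rw [Finset.filter_erase, Finset.card_erase_add_one]
    exact Finset.mem_filter.2 ⟨hy, rfl⟩
  have h2 : ∏ b ∈ T.erase (β y), qFactorial q ((A.erase y).filter fun z => β z = b).card =
      ∏ b ∈ T.erase (β y), qFactorial q (A.filter fun z => β z = b).card := by
    refine Finset.prod_congr rfl fun b hb => ?_
    rw [Finset.filter_erase, Finset.erase_eq_of_notMem]
    intro h
    exact (Finset.mem_erase.1 hb).1 (Finset.mem_filter.1 h).2.symm
  rw [h2, ← h1, qFactorial_succ]
  ring

/-- Summation over the letters by label classes, each represented by its largest letter. -/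
theorem sum_tops {q : K} {β : ℤ → ℤ} {A : Finset ℤ} (hβ : MonotoneOn β A) (f : ℤ → K)
    (hf : ∀ y ∈ A, ∀ z ∈ A, β y = β z → f y = f z) :
    ∑ y ∈ tops β A, f y * (q ^ cardGT A y * qInt q (A.filter fun z => β z = β y).card) =
      ∑ z ∈ A, f z * q ^ cardGT A z := by
  have hmap : ∀ z ∈ A, ∃ y ∈ tops β A, β y = β z := by
    intro z hz
    obtain ⟨y, hy, hy'⟩ := Finset.exists_max_image (A.filter fun w => β w = β z) id
      ⟨z, Finset.mem_filter.2 ⟨hz, rfl⟩⟩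
    rw [Finset.mem_filter] at hy
    refine ⟨y, Finset.mem_filter.2 ⟨hy.1, fun w hw hwy => ?_⟩, hy.2⟩
    exact hy' w (Finset.mem_filter.2 ⟨hw, hwy.trans hy.2⟩)
  choose! t ht ht' using hmap
  rw [← Finset.sum_fiberwise_of_maps_to ht]
  refine Finset.sum_congr rfl fun y hy => ?_
  have hy' := Finset.mem_filter.1 hy
  have hfib : (A.filter fun z => t z = y) = A.filter fun z => β z = β y := by
    refine Finset.filter_congr fun z hz => ?_
    constructor
    · rintro rfl
      exact (ht' z hz).symm
    · intro h
      have h1 := Finset.mem_filter.1 (ht z hz)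
      refine le_antisymm (hy'.2 _ h1.1 ((ht' z hz).trans h)) (h1.2 _ hy'.1 ?_)
      rw [ht' z hz, h]
  rw [hfib, ← sum_pow_cardGT, Finset.mul_sum, Finset.mul_sum]
  refine Finset.sum_congr rfl fun z hz => ?_
  obtain ⟨hz, hzy⟩ := Finset.mem_filter.1 hz
  rw [hf y hy'.1 z hz hzy.symm, ← pow_add]
  congr 2
  -- By monotonicity of `β` a class is an interval of `A`: the letters of `A` above `z` are those
  -- above the top `y` of the class, together with those of the class that exceed `z`.
  rw [cardGT, cardGT, cardGT, Finset.filter_filter, ← Finset.card_union_of_disjoint]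
  · congr 1
    ext w
    simp only [Finset.mem_filter, Finset.mem_union]
    constructor
    · rintro (⟨h1, h2⟩ | ⟨h1, h2, h3⟩)
      · exact ⟨h1, (hy'.2 z hz hzy).trans_lt h2⟩
      · exact ⟨h1, h3⟩
    · rintro ⟨h1, h2⟩
      by_cases h3 : y < w
      · exact Or.inl ⟨h1, h3⟩
      · refine Or.inr ⟨h1, le_antisymm (hβ h1 hy'.1 (not_lt.1 h3)) ?_, h2⟩
        rw [← hzy]
        exact hβ hz h1 h2.le
  · rw [Finset.disjoint_filter]
    exact fun w hw h3 h4 => absurd (hy'.2 w hw h4.1) (not_le.2 h3)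

/-- The contribution of a descent from the head of `l` to a letter `x` that follows it. -/
def headDesc (x : ℤ) : List ℤ → ℕ
  | [] => 0
  -- The list is reversed, so `y` stands at position `l.length + 1` from the left.
  | y :: l => if x < y then l.length + 1 else 0

/-- The major index of a word read from right to left. -/
def revMaj : List ℤ → ℕ
  | [] => 0
  | x :: l => revMaj l + headDesc x l

/-- The inversion number of a word read from right to left. -/
def revInv : List ℤ → ℕ
  | [] => 0
  | x :: l => revInv l + l.countP (x < ·)

theorem length_of_mem_words {β : ℤ → ℤ} {A : Finset ℤ} {l : List ℤ} (h : l ∈ words β A) :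
    l.length = A.card := by
  rw [← Multiset.coe_card, (mem_words.1 h).1]; rfl

theorem countP_of_mem_words {β : ℤ → ℤ} {A : Finset ℤ} {l : List ℤ} (h : l ∈ words β A) (x : ℤ) :
    l.countP (x < ·) = cardGT A x := by
  rw [cardGT, Finset.card_def, Finset.filter_val, ← (mem_words.1 h).1, Multiset.filter_coe,
    Multiset.coe_card, List.countP_eq_length_filter]

/-- Removing the rightmost letter `y` removes `cardGT A y` inversions. The class of `y` loses one
letter, and `sum_tops` turns the resulting sum over tops into a sum over all of `A`. -/
theorem sum_words_revInv {q : K} {β : ℤ → ℤ} {T : Finset ℤ}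
    (k : ℕ) (A : Finset ℤ) (hk : A.card = k) (hβ : MonotoneOn β A) (hT : ∀ z ∈ A, β z ∈ T) :
    (∑ l ∈ words β A, q ^ revInv l) * classFactorial q β T A = qFactorial q k := by
  induction k generalizing A with
  | zero =>
    rw [Finset.card_eq_zero] at hk
    subst hk
    simp [words_empty, revInv, classFactorial, qFactorial_zero]
  | succ k ih =>
    have hne : A.Nonempty := Finset.card_pos.1 (by omega)
    rw [sum_words hne, Finset.sum_mul, qFactorial_succ, ← hk, ← sum_pow_cardGT]
    have h1 : ∀ y ∈ tops β A, (∑ l ∈ words β (A.erase y), q ^ revInv (y :: l)) *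
        classFactorial q β T A = qFactorial q k *
          (q ^ cardGT A y * qInt q (A.filter fun z => β z = β y).card) := by
      intro y hy
      have hy' := (Finset.mem_filter.1 hy).1
      have hyc : (A.erase y).card = k := by rw [Finset.card_erase_of_mem hy']; omega
      have := ih (A.erase y) hyc (hβ.mono (by simp))
        (fun z hz => hT z (Finset.mem_of_mem_erase hz))
      rw [← this, classFactorial_erase q hy' (hT y hy')]
      have h2 : ∑ l ∈ words β (A.erase y), q ^ revInv (y :: l) =
          (∑ l ∈ words β (A.erase y), q ^ revInv l) * q ^ cardGT A y := by
        rw [Finset.sum_mul]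
        refine Finset.sum_congr rfl fun l hl => ?_
        rw [revInv, countP_of_mem_words hl, pow_add]
        congr 2
        rw [cardGT, cardGT, Finset.filter_erase, Finset.erase_eq_of_notMem]
        simp
      rw [h2]
      ring
    rw [Finset.sum_congr rfl h1, ← Finset.mul_sum]
    congr 1
    simpa using sum_tops (q := q) hβ (fun _ => 1) (fun _ _ _ _ _ => rfl)

/-- The induction for the major index needs control of the last letter, so a fixed letter `x` is
appended. If `x` separates no class, the sum depends on `x` only through the factor `q ^ cardGT A
x`: a descent from the previous letter `y` to `x` adds `#A`, which is the shift of ranks in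
`sum_pow_cardGT_shift`. -/
theorem sum_words_revMaj_cons {q : K} {β : ℤ → ℤ}
    {T : Finset ℤ} (k : ℕ) (A : Finset ℤ) (hk : A.card = k) (hβ : MonotoneOn β A)
    (hT : ∀ z ∈ A, β z ∈ T) (x : ℤ)
    (hx : ∀ y ∈ A, ∀ z ∈ A, β y = β z → (x < y ↔ x < z)) :
    (∑ l ∈ words β A, q ^ revMaj (x :: l)) * classFactorial q β T A =
      q ^ cardGT A x * qFactorial q k := by
  induction k generalizing A x with
  | zero =>
    rw [Finset.card_eq_zero] at hk
    subst hk
    simp [words_empty, revMaj, headDesc, classFactorial, qFactorial_zero, cardGT]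
  | succ k ih =>
    have hne : A.Nonempty := Finset.card_pos.1 (by omega)
    have h1 : ∀ y ∈ tops β A, (∑ l ∈ words β (A.erase y), q ^ revMaj (x :: y :: l)) *
        classFactorial q β T A = qFactorial q k * (q ^ (if x < y then A.card else 0) *
          (q ^ cardGT A y * qInt q (A.filter fun z => β z = β y).card)) := by
      intro y hy
      obtain ⟨hy', hytop⟩ := Finset.mem_filter.1 hy
      have hyc : (A.erase y).card = k := by rw [Finset.card_erase_of_mem hy']; omega
      -- The induction hypothesis is applied with `y` as the appended letter. Since `y` is the
      -- largest letter of its class and classes are intervals, it separates no class of what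
      -- remains.
      have hcut : ∀ z ∈ A.erase y, ∀ w ∈ A.erase y, β z = β w → y < z → y < w := by
        intro z hz w hw hzw hyz
        rw [Finset.mem_erase] at hz hw
        by_contra hwy
        have h2 := hβ hw.2 hy' (not_lt.1 hwy)
        have h3 := hβ hy' hz.2 hyz.le
        have := hytop z hz.2 (by omega)
        omega
      have := ih (A.erase y) hyc (hβ.mono (by simp))
        (fun z hz => hT z (Finset.mem_of_mem_erase hz)) y
        (fun z hz w hw h => ⟨hcut z hz w hw h, hcut w hw z hz h.symm⟩)
      have hgt : cardGT (A.erase y) y = cardGT A y := by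
        rw [cardGT, cardGT, Finset.filter_erase, Finset.erase_eq_of_notMem]
        simp
      rw [hgt] at this
      rw [classFactorial_erase q hy' (hT y hy')]
      have h2 : ∑ l ∈ words β (A.erase y), q ^ revMaj (x :: y :: l) =
          (∑ l ∈ words β (A.erase y), q ^ revMaj (y :: l)) *
            q ^ (if x < y then A.card else 0) := by
        rw [Finset.sum_mul]
        refine Finset.sum_congr rfl fun l hl => ?_
        rw [revMaj, headDesc, length_of_mem_words hl, hyc, hk, pow_add]
      rw [h2, mul_right_comm, ← mul_assoc, this]
      ring
    rw [sum_words hne, Finset.sum_mul, Finset.sum_congr rfl h1, ← Finset.mul_sum,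
      sum_tops hβ (fun z => q ^ (if x < z then A.card else 0))
        (fun y hy z hz h => by simp only [hx y hy z hz h])]
    simp only [← pow_add]
    rw [sum_pow_cardGT_shift, qFactorial_succ, hk]
    ring

/-- Appending an upper bound of the alphabet creates no descent and has rank `0`. -/
theorem sum_words_revMaj {q : K} {β : ℤ → ℤ} {T : Finset ℤ}
    (A : Finset ℤ) (hβ : MonotoneOn β A) (hT : ∀ z ∈ A, β z ∈ T) :
    (∑ l ∈ words β A, q ^ revMaj l) * classFactorial q β T A = qFactorial q A.card := by
  obtain ⟨x, hx⟩ := A.bddAbove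
  have hx' : ∀ y ∈ A, ¬ x < y := fun y hy => not_lt.2 (hx hy)
  have := sum_words_revMaj_cons (q := q) (T := T) A.card A rfl hβ hT x
    (fun y hy z hz _ => by simp [hx' y hy, hx' z hz])
  have h0 : cardGT A x = 0 := by
    rw [cardGT, Finset.card_eq_zero, Finset.filter_eq_empty_iff]
    exact fun y hy => hx' y hy
  rw [h0, pow_zero, one_mul] at this
  rw [← this]
  congr 1
  refine Finset.sum_congr rfl fun l hl => ?_
  rw [revMaj]
  cases l with
  | nil => rfl
  | cons y l => rw [headDesc, if_neg (hx' y (Finset.mem_filter.1 (cons_mem_words.1 hl).1).1)]; rfl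

end Words

/-! ### `dmaj` and length as a word statistic plus a sum over negative letters -/

section Statistics

/-- The word `w k, …, w 2, w 1`. -/
def revWord (w : ℕ → ℤ) : ℕ → List ℤ
  | 0 => []
  | k + 1 => w (k + 1) :: revWord w k

theorem mem_revWord {w : ℕ → ℤ} {k : ℕ} {z : ℤ} :
    z ∈ revWord w k ↔ ∃ i, 1 ≤ i ∧ i ≤ k ∧ w i = z := by
  induction k with
  | zero =>
    simp only [revWord, List.not_mem_nil, false_iff]
    rintro ⟨i, h1, h2, -⟩
    omega
  | succ k ih =>
    rw [revWord, List.mem_cons, ih]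
    constructor
    · rintro (rfl | ⟨i, h1, h2, h3⟩)
      · exact ⟨k + 1, by omega, le_rfl, rfl⟩
      · exact ⟨i, h1, by omega, h3⟩
    · rintro ⟨i, h1, h2, h3⟩
      rcases eq_or_lt_of_le h2 with rfl | h4
      · exact Or.inl h3.symm
      · exact Or.inr ⟨i, h1, by omega, h3⟩

theorem pairwise_revWord {w : ℕ → ℤ} {k : ℕ} {R : ℤ → ℤ → Prop} :
    (revWord w k).Pairwise R ↔ ∀ i j, 1 ≤ j → j < i → i ≤ k → R (w i) (w j) := by
  induction k with
  | zero =>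
    simp only [revWord, List.Pairwise.nil, true_iff]
    intro i j h1 h2 h3
    omega
  | succ k ih =>
    rw [revWord, List.pairwise_cons, ih]
    constructor
    · rintro ⟨h1, h2⟩ i j h3 h4 h5
      rcases eq_or_lt_of_le h5 with rfl | h6
      · exact h1 _ (mem_revWord.2 ⟨j, h3, by omega, rfl⟩)
      · exact h2 i j h3 h4 (by omega)
    · intro h
      refine ⟨fun z hz => ?_, fun i j h3 h4 h5 => h i j h3 h4 (by omega)⟩
      obtain ⟨j, h1, h2, rfl⟩ := mem_revWord.1 hz
      exact h _ _ h1 (by omega) le_rfl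

theorem revWord_congr {w w' : ℕ → ℤ} {k : ℕ} (h : ∀ i, 1 ≤ i → i ≤ k → w i = w' i) :
    revWord w k = revWord w' k := by
  induction k with
  | zero => rfl
  | succ k ih =>
    rw [revWord, revWord, h _ (by omega) le_rfl, ih fun i h1 h2 => h i h1 (by omega)]

theorem eq_of_revWord_eq {w w' : ℕ → ℤ} {k : ℕ} (h : revWord w k = revWord w' k) {i : ℕ}
    (h1 : 1 ≤ i) (h2 : i ≤ k) : w i = w' i := by
  induction k with
  | zero => omega
  | succ k ih =>
    simp only [revWord, List.cons.injEq] at h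
    rcases eq_or_lt_of_le h2 with rfl | h3
    · exact h.1
    · exact ih h.2 (by omega)

theorem exists_revWord_eq (l : List ℤ) : ∃ w : ℕ → ℤ, revWord w l.length = l := by
  induction l with
  | nil => exact ⟨fun _ => 0, rfl⟩
  | cons x l ih =>
    obtain ⟨w, hw⟩ := ih
    refine ⟨fun i => if i = l.length + 1 then x else w i, ?_⟩
    rw [List.length_cons, revWord, if_pos rfl]
    congr 1
    conv_rhs => rw [← hw]
    exact revWord_congr fun i h1 h2 => if_neg (by omega)

theorem length_revWord (w : ℕ → ℤ) (k : ℕ) : (revWord w k).length = k := by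
  induction k with
  | zero => rfl
  | succ k ih => rw [revWord, List.length_cons, ih]

theorem countP_revWord (w : ℕ → ℤ) (k : ℕ) (x : ℤ) :
    (revWord w k).countP (x < ·) = ((Finset.Icc 1 k).filter fun i => x < w i).card := by
  induction k with
  | zero => simp [revWord]
  | succ k ih =>
    rw [revWord, List.countP_cons, ih, ← Finset.insert_Icc_right_eq_Icc_add_one (by omega),
      Finset.filter_insert]
    split_ifs with h1 h2 h2
    · rw [Finset.card_insert_of_notMem (by simp)]
    · simp_all
    · simp_all
    · rfl

theorem revInv_revWord (w : ℕ → ℤ) (k : ℕ) : revInv (revWord w k) =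
    ∑ j ∈ Finset.Icc 1 k, ((Finset.Icc 1 (j - 1)).filter fun i => w j < w i).card := by
  induction k with
  | zero => rfl
  | succ k ih =>
    rw [revWord, revInv, ih, countP_revWord, Finset.sum_Icc_succ_top (by omega)]
    rfl

theorem revMaj_revWord (w : ℕ → ℤ) (k : ℕ) : revMaj (revWord w k) =
    ∑ i ∈ (Finset.Ico 1 k).filter (fun i => w (i + 1) < w i), i := by
  induction k with
  | zero => rfl
  | succ k ih =>
    rw [revWord, revMaj, ih]
    rcases k with _ | k
    · rfl
    · rw [revWord, headDesc, length_revWord, Finset.sum_filter, Finset.sum_filter,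
        Finset.sum_Ico_succ_top (by omega : 1 ≤ k + 1)]

theorem win_inv_eq {n : ℕ} {γ : Equiv.Perm (Pt n)} {i a : ℕ} (hi : 1 ≤ i ∧ i ≤ n)
    (ha : 1 ≤ a ∧ a ≤ n) : win γ⁻¹ a = i ↔ win γ i = a := by
  rw [win_of_mem _ hi, win_of_mem _ ha]
  have e1 : (γ⁻¹ (pt a ha)).1 = i ↔ γ⁻¹ (pt a ha) = pt i hi := by rw [Subtype.ext_iff, coe_pt]
  have e2 : (γ (pt i hi)).1 = a ↔ γ (pt i hi) = pt a ha := by rw [Subtype.ext_iff, coe_pt]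
  rw [e1, e2, Equiv.Perm.inv_eq_iff_eq, eq_comm]

theorem win_inv_eq_neg {n : ℕ} {γ : Equiv.Perm (Pt n)} (hγ : γ ∈ B n) {i a : ℕ}
    (hi : 1 ≤ i ∧ i ≤ n) (ha : 1 ≤ a ∧ a ≤ n) : win γ⁻¹ a = -i ↔ win γ i = -a := by
  have hγ' : ∀ x, γ (-x) = -γ x := hγ
  rw [win_of_mem _ hi, win_of_mem _ ha]
  have e1 : (γ⁻¹ (pt a ha)).1 = -i ↔ γ⁻¹ (pt a ha) = -pt i hi := by
    rw [Subtype.ext_iff, coe_neg, coe_pt]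
  have e2 : (γ (pt i hi)).1 = -a ↔ γ (pt i hi) = -pt a ha := by
    rw [Subtype.ext_iff, coe_neg, coe_pt]
  rw [e1, e2, Equiv.Perm.inv_eq_iff_eq, hγ', eq_comm, neg_eq_iff_eq_neg]

theorem win_bounds {n : ℕ} (γ : Equiv.Perm (Pt n)) {i : ℕ} (hi : 1 ≤ i ∧ i ≤ n) :
    win γ i ≠ 0 ∧ -(n : ℤ) ≤ win γ i ∧ win γ i ≤ n := by
  rw [win_of_mem _ hi]
  exact (γ _).2

/-- The set of the absolute values of the negative entries of the window of `γ`. -/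
noncomputable def negSet {n : ℕ} (γ : Equiv.Perm (Pt n)) : Finset ℕ :=
  (Finset.Icc 1 n).filter fun a => win γ⁻¹ a < 0

theorem mem_negSet {n : ℕ} {γ : Equiv.Perm (Pt n)} {a : ℕ} :
    a ∈ negSet γ ↔ (1 ≤ a ∧ a ≤ n) ∧ win γ⁻¹ a < 0 := by
  rw [negSet, Finset.mem_filter, Finset.mem_Icc]

theorem dmaj_eq {n : ℕ} (γ : D n) :
    dmaj γ = revMaj (revWord (win γ.1) n) + ∑ a ∈ negSet γ.1, (a - 1) := by
  have hγ := γ.2.1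
  rw [dmaj, DDes, Multiset.sum_add, revMaj_revWord]
  congr 1
  · rw [Des]
    exact (congrArg Multiset.sum (Multiset.map_id' _).symm)
  -- The zeros discarded in `DDes` do not affect the sum.
  have h0 : ∀ s : Multiset ℕ, (s.filter fun j => j ≠ 0).sum = s.sum := by
    intro s
    induction s using Multiset.induction with
    | empty => rfl
    | cons a s ih =>
      by_cases h : a = 0
      · subst h
        simpa using ih
      · simpa [h] using ih
  rw [h0]
  change ∑ i ∈ (Finset.Icc 1 n).filter (fun i => win γ.1 i < 0), (-win γ.1 i - 1).toNat = _
  refine Finset.sum_bij' (fun i _ => (win γ.1 i).natAbs) (fun a _ => (win γ.1⁻¹ a).natAbs)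
    ?_ ?_ ?_ ?_ ?_
  · intro i hi
    rw [Finset.mem_filter, Finset.mem_Icc] at hi
    have hb := win_bounds γ.1 hi.1
    have := (win_inv_eq_neg hγ (a := (win γ.1 i).natAbs) hi.1 (by omega)).2 (by omega)
    rw [mem_negSet]
    omega
  · intro a ha
    rw [mem_negSet] at ha
    have hb := win_bounds γ.1⁻¹ ha.1
    have := (win_inv_eq_neg hγ (i := (win γ.1⁻¹ a).natAbs) (by omega) ha.1).1 (by omega)
    rw [Finset.mem_filter, Finset.mem_Icc]
    omega
  · intro i hi
    rw [Finset.mem_filter, Finset.mem_Icc] at hi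
    have hb := win_bounds γ.1 hi.1
    have := (win_inv_eq_neg hγ (a := (win γ.1 i).natAbs) hi.1 (by omega)).2 (by omega)
    omega
  · intro a ha
    rw [mem_negSet] at ha
    have hb := win_bounds γ.1⁻¹ ha.1
    have := (win_inv_eq_neg hγ (i := (win γ.1⁻¹ a).natAbs) (by omega) ha.1).1 (by omega)
    omega
  · intro i hi
    rw [Finset.mem_filter, Finset.mem_Icc] at hi
    omega

theorem coe_apply_of_pos {n : ℕ} (γ : Equiv.Perm (Pt n)) {x : Pt n} (hx : 0 < x.1) :
    (γ x).1 = win γ x.1.natAbs := by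
  have hx' := x.2
  rw [win_of_mem γ (by omega)]
  congr 2
  exact Subtype.ext (by rw [coe_pt]; omega)

theorem card_posInv {n : ℕ} (γ : Equiv.Perm (Pt n)) :
    ((rootInv γ).filter fun p => 0 < p.1.1).card = revInv (revWord (win γ) n) := by
  rw [revInv_revWord, ← Finset.card_sigma]
  refine Finset.card_bij (fun p _ => ⟨p.2.1.natAbs, p.1.1.natAbs⟩) ?_ ?_ ?_
  · rintro ⟨x, y⟩ h
    have hx := x.2
    have hy := y.2
    rw [Finset.mem_filter, mem_rootInv] at h
    obtain ⟨⟨h1, h2, h3⟩, h4⟩ := h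
    dsimp only at h4
    rw [coe_apply_of_pos γ h4, coe_apply_of_pos γ (h4.trans h1)] at h3
    rw [Finset.mem_sigma, Finset.mem_filter, Finset.mem_Icc, Finset.mem_Icc]
    dsimp only
    omega
  · rintro ⟨x, y⟩ h ⟨x', y'⟩ h' he
    rw [Finset.mem_filter, mem_rootInv] at h h'
    simp only [Sigma.mk.injEq, heq_eq_eq] at he
    dsimp only at h h'
    refine Prod.ext (Subtype.ext ?_) (Subtype.ext ?_) <;> dsimp only <;> omega
  · rintro ⟨j, i⟩ h
    rw [Finset.mem_sigma, Finset.mem_filter, Finset.mem_Icc, Finset.mem_Icc] at h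
    dsimp only at h
    refine ⟨(pt i (by omega), pt j (by omega)), ?_, by simp⟩
    rw [Finset.mem_filter, mem_rootInv, ← win_of_mem, ← win_of_mem, coe_pt, coe_pt]
    omega

/-- Each `a` in `negSet γ` determines `x = γ⁻¹(a) < 0`, and each `b < a` determines the unique
positive `y` with `|γ(y)| = b`. This makes `a - 1` pairs. -/
theorem card_mixedInv {n : ℕ} {γ : Equiv.Perm (Pt n)} (hγ : γ ∈ B n) :
    ((rootInv γ).filter fun p => p.1.1 < 0 ∧ 0 < p.2.1 ∧
      (γ p.2).1.natAbs < (γ p.1).1.natAbs).card = ∑ a ∈ negSet γ, (a - 1) := by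
  have hγ' : ∀ x, γ (-x) = -γ x := hγ
  have hsum : ∑ a ∈ negSet γ, (a - 1) = ∑ a ∈ negSet γ, (Finset.Icc 1 (a - 1)).card := by simp
  rw [hsum, ← Finset.card_sigma]
  refine Finset.card_bij (fun p _ => ⟨(γ p.1).1.natAbs, (γ p.2).1.natAbs⟩) ?_ ?_ ?_
  · rintro ⟨x, y⟩ h
    rw [Finset.mem_filter, mem_rootInv] at h
    dsimp only at h
    have hx := (γ x).2
    have hy := (γ y).2
    rw [Finset.mem_sigma, mem_negSet, Finset.mem_Icc]
    dsimp only
    have h1 : γ⁻¹ (pt (γ x).1.natAbs (by omega)) = x := by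
      rw [Equiv.Perm.inv_eq_iff_eq]
      exact Subtype.ext (by rw [coe_pt]; omega)
    rw [win_of_mem _ (by omega), h1]
    omega
  · rintro ⟨x, y⟩ h ⟨x', y'⟩ h' he
    rw [Finset.mem_filter, mem_rootInv] at h h'
    simp only [Sigma.mk.injEq, heq_eq_eq] at he
    dsimp only at h h'
    have e1 : x = x' := γ.injective (Subtype.ext (by omega))
    have e2 : y = y' := by
      by_cases h0 : (γ y).1 = (γ y').1
      · exact γ.injective (Subtype.ext h0)
      · have h1 : γ y = γ (-y') := by
          rw [hγ']
          exact Subtype.ext (by rw [coe_neg]; omega)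
        have h2 := congrArg Subtype.val (γ.injective h1)
        rw [coe_neg] at h2
        omega
    rw [e1, e2]
  · rintro ⟨a, b⟩ h
    rw [Finset.mem_sigma, mem_negSet, Finset.mem_Icc] at h
    dsimp only at h
    obtain ⟨⟨ha, ha'⟩, hb⟩ := h
    rw [win_of_mem _ ha] at ha'
    have hx : γ (γ⁻¹ (pt a ha)) = pt a ha := γ.apply_symm_apply _
    have hb' : 1 ≤ b ∧ b ≤ n := by omega
    obtain ⟨y, hy, hy'⟩ : ∃ y : Pt n, 0 < y.1 ∧ (γ y).1.natAbs = b := by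
      have hz : γ (γ⁻¹ (pt b hb')) = pt b hb' := γ.apply_symm_apply _
      rcases lt_or_gt_of_ne (γ⁻¹ (pt b hb')).2.1 with h0 | h0
      · refine ⟨-γ⁻¹ (pt b hb'), by rw [coe_neg]; omega, ?_⟩
        rw [hγ', hz]; simp
      · exact ⟨_, h0, by rw [hz]; simp⟩
    have hγy := (γ y).2
    refine ⟨(γ⁻¹ (pt a ha), y), ?_, ?_⟩
    · rw [Finset.mem_filter, mem_rootInv]
      dsimp only
      rw [hx, coe_pt]
      refine ⟨⟨by omega, fun h0 => ?_, by omega⟩, ha', hy, by omega⟩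
      have : γ (γ⁻¹ (pt a ha)) = γ (-y) := by
        congr 1
        exact Subtype.ext (by rw [coe_neg]; omega)
      rw [hx, hγ'] at this
      have := congrArg Subtype.val this
      rw [coe_pt, coe_neg] at this
      omega
    · dsimp only
      rw [hx, hy']
      simp

/-- The two copies of a root are exchanged by `(x, y) ↦ (-y, -x)`. One representative of each is
chosen: the pairs of positive points, and the pairs of mixed sign in which the negative point has
the image of larger absolute value. -/
theorem card_rootInv_eq {n : ℕ} {γ : Equiv.Perm (Pt n)} (hγ : γ ∈ B n) :
    (rootInv γ).card = 2 * (revInv (revWord (win γ) n) + ∑ a ∈ negSet γ, (a - 1)) := by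
  have hγ' : ∀ x, γ (-x) = -γ x := hγ
  have hdisj : Disjoint ((rootInv γ).filter fun p => 0 < p.1.1)
      ((rootInv γ).filter fun p => p.1.1 < 0 ∧ 0 < p.2.1 ∧
        (γ p.2).1.natAbs < (γ p.1).1.natAbs) := by
    rw [Finset.disjoint_filter]
    intro p _ h1 h2
    omega
  rw [← card_posInv, ← card_mixedInv hγ, ← Finset.card_union_of_disjoint hdisj,
    ← Finset.filter_or, ← Finset.card_filter_add_card_filter_not (s := rootInv γ)
      (fun p => 0 < p.1.1 ∨ p.1.1 < 0 ∧ 0 < p.2.1 ∧ (γ p.2).1.natAbs < (γ p.1).1.natAbs), two_mul]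
  congr 1
  refine Finset.card_bij' (fun p _ => (-p.2, -p.1)) (fun p _ => (-p.2, -p.1)) ?_ ?_ ?_ ?_
  · rintro ⟨x, y⟩ h
    have hx := x.2
    have hy := y.2
    rw [Finset.mem_filter, mem_rootInv] at h ⊢
    have := ne_of_B hγ h.1.2.1
    simp only [hγ', coe_neg] at h ⊢
    omega
  · rintro ⟨x, y⟩ h
    have hx := x.2
    have hy := y.2
    rw [Finset.mem_filter, mem_rootInv] at h ⊢
    have := ne_of_B hγ h.1.2.1
    simp only [hγ', coe_neg] at h ⊢
    omega
  · rintro ⟨x, y⟩ -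
    simp
  · rintro ⟨x, y⟩ -
    simp

theorem length_eq {n : ℕ} (γ : D n) :
    length γ = revInv (revWord (win γ.1) n) + ∑ a ∈ negSet γ.1, (a - 1) := by
  have h1 := two_mul_length γ
  rw [card_rootInv_eq γ.2.1] at h1
  omega

end Statistics

/-! ### Blocks of `[n]` cut out by `M`, and signed alphabets -/

section Blocks

/-- The largest element of `M` below `a` (zero if there is none). -/
def start (M : Finset ℕ) (a : ℕ) : ℕ := (M.filter (· < a)).sup id

theorem start_mono (M : Finset ℕ) : Monotone (start M) := by
  intro a b hab
  refine Finset.sup_mono fun m hm => ?_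
  rw [Finset.mem_filter] at hm ⊢
  exact ⟨hm.1, hm.2.trans_le hab⟩

theorem start_lt {M : Finset ℕ} {a : ℕ} (ha : 1 ≤ a) : start M a < a := by
  rw [start, Finset.sup_lt_iff (show (⊥ : ℕ) < a from ha)]
  intro m hm
  exact (Finset.mem_filter.1 hm).2

theorem le_start {M : Finset ℕ} {m a : ℕ} (hm : m ∈ M) (h : m < a) : m ≤ start M a :=
  Finset.le_sup (f := id) (Finset.mem_filter.2 ⟨hm, h⟩)

theorem start_succ {M : Finset ℕ} {i : ℕ} (hi : i ∉ M) : start M (i + 1) = start M i := by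
  rw [start, start]
  congr 1
  refine Finset.filter_congr fun m hm => ?_
  have : m ≠ i := fun h => hi (h ▸ hm)
  omega

theorem notMem_of_start_eq {M : Finset ℕ} {a b m : ℕ} (h : start M a = start M b) (ha : 1 ≤ a)
    (h1 : a ≤ m) (h2 : m < b) : m ∉ M := by
  intro hm
  have := le_start hm h2
  have := start_lt (M := M) ha
  omega

/-- `N` contains, with each letter, the preceding letters of the same block. -/
def IsInitial (n : ℕ) (M N : Finset ℕ) : Prop :=
  N ⊆ Finset.Icc 1 n ∧ ∀ i, 1 ≤ i → i < n → i ∉ M → i + 1 ∈ N → i ∈ N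

theorem eq_Ioc_of_pred_mem {U : Finset ℕ} {s : ℕ} (h1 : ∀ a ∈ U, s < a)
    (h2 : ∀ a, s < a → a + 1 ∈ U → a ∈ U) : U = Finset.Ioc s (s + U.card) := by
  rcases U.eq_empty_or_nonempty with rfl | hne
  · simp
  have hU : U = Finset.Ioc s (U.max' hne) := by
    ext a
    rw [Finset.mem_Ioc]
    constructor
    · exact fun ha => ⟨h1 a ha, U.le_max' a ha⟩
    · rintro ⟨h3, h4⟩
      have : ∀ k, U.max' hne - k > s → U.max' hne - k ∈ U := by
        intro k
        induction k with
        | zero => exact fun _ => U.max'_mem hne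
        | succ k ih =>
          intro hk
          refine h2 _ hk ?_
          have : U.max' hne - (k + 1) + 1 = U.max' hne - k := by omega
          rw [this]
          exact ih (by omega)
      have h5 := this (U.max' hne - a) (by omega)
      rwa [show U.max' hne - (U.max' hne - a) = a by omega] at h5
  have h3 := h1 _ (U.max'_mem hne)
  have h4 : U.card = U.max' hne - s := by
    conv_lhs => rw [hU]
    simp
  rw [h4, show s + (U.max' hne - s) = U.max' hne by omega]
  exact hU

theorem IsInitial.filter_start {n : ℕ} {M N : Finset ℕ} (h : IsInitial n M N) (s : ℕ) :
    (N.filter fun a => start M a = s) =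
      Finset.Ioc s (s + (N.filter fun a => start M a = s).card) := by
  refine eq_Ioc_of_pred_mem (fun a ha => ?_) fun a hsa ha => ?_
  · obtain ⟨h1, rfl⟩ := Finset.mem_filter.1 ha
    exact start_lt (Finset.mem_Icc.1 (h.1 h1)).1
  · obtain ⟨h1, h2⟩ := Finset.mem_filter.1 ha
    have h3 := Finset.mem_Icc.1 (h.1 h1)
    have h4 : a ∉ M := by
      intro h5
      have := le_start h5 (Nat.lt_succ_self a)
      have e : a.succ = a + 1 := rfl
      rw [e] at this
      omega
    rw [start_succ h4] at h2
    exact Finset.mem_filter.2 ⟨h.2 a (by omega) (by omega) h4 h1, h2⟩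

theorem isInitial_Icc (n : ℕ) (M : Finset ℕ) : IsInitial n M (Finset.Icc 1 n) :=
  ⟨Finset.Subset.rfl, fun _ h1 h2 _ _ => Finset.mem_Icc.2 ⟨h1, h2.le⟩⟩

/-- The size of the block of `[n]` that begins after `s`. -/
def blockCard (n : ℕ) (M : Finset ℕ) (s : ℕ) : ℕ :=
  ((Finset.Icc 1 n).filter fun a => start M a = s).card

theorem filter_start_eq_Ioc (n : ℕ) (M : Finset ℕ) (s : ℕ) :
    ((Finset.Icc 1 n).filter fun a => start M a = s) = Finset.Ioc s (s + blockCard n M s) :=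
  (isInitial_Icc n M).filter_start s

/-- The label of a letter: its block together with its sign. -/
def label (M : Finset ℕ) (z : ℤ) : ℤ := Int.sign z * (start M z.natAbs + 1)

theorem label_of_pos (M : Finset ℕ) {z : ℤ} (h : 0 < z) :
    label M z = start M z.natAbs + 1 := by
  rw [label, Int.sign_eq_one_of_pos h, one_mul]

theorem label_of_neg (M : Finset ℕ) {z : ℤ} (h : z < 0) :
    label M z = -(start M z.natAbs + 1) := by
  rw [label, Int.sign_eq_neg_one_of_neg h]
  ring

/-- The sign is odd and `start M` is monotone in the absolute value; the `+ 1` in the label keeps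
the two signs apart in the block that begins after `0`. Monotonicity is what makes the label classes
intervals. -/
theorem label_mono (M : Finset ℕ) : Monotone (label M) := by
  intro x y hxy
  have h0 : label M 0 = 0 := by simp [label]
  rcases lt_trichotomy x 0 with h1 | rfl | h1 <;> rcases lt_trichotomy y 0 with h2 | rfl | h2 <;>
    try rw [label_of_neg M h1]
  all_goals try rw [label_of_pos M h1]
  all_goals try rw [label_of_neg M h2]
  all_goals try rw [label_of_pos M h2]
  all_goals try rw [h0]
  all_goals try omega
  · have := start_mono M (show y.natAbs ≤ x.natAbs by omega)
    omega
  · have := start_mono M (show x.natAbs ≤ y.natAbs by omega)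
    omega

/-- The letter with absolute value `a`, if the letters in `N` carry a negative sign. -/
def letter (N : Finset ℕ) (a : ℕ) : ℤ := if a ∈ N then -a else a

theorem natAbs_letter (N : Finset ℕ) (a : ℕ) : (letter N a).natAbs = a := by
  rw [letter]; split_ifs <;> simp

theorem letter_injective (N : Finset ℕ) : Function.Injective (letter N) := fun a b h => by
  rw [← natAbs_letter N a, h, natAbs_letter]

/-- The alphabet `[n]` with negative signs at the elements of `N`. -/
def letters (n : ℕ) (N : Finset ℕ) : Finset ℤ := (Finset.Icc 1 n).image (letter N)

theorem mem_letters {n : ℕ} {N : Finset ℕ} {z : ℤ} :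
    z ∈ letters n N ↔ ∃ a, (1 ≤ a ∧ a ≤ n) ∧ letter N a = z := by
  simp [letters]

theorem card_letters (n : ℕ) (N : Finset ℕ) : (letters n N).card = n := by
  rw [letters, Finset.card_image_of_injective _ (letter_injective N)]
  simp

/-- The labels of the letters with absolute value at most `n`. -/
def labels (n : ℕ) : Finset ℤ :=
  (Finset.range n).image (fun s : ℕ => (s : ℤ) + 1) ∪
    (Finset.range n).image (fun s : ℕ => -((s : ℤ) + 1))

theorem label_mem_labels {n : ℕ} {M N : Finset ℕ} {z : ℤ} (hz : z ∈ letters n N) :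
    label M z ∈ labels n := by
  obtain ⟨a, ha, rfl⟩ := mem_letters.1 hz
  have h1 := natAbs_letter N a
  have h2 := start_lt (M := M) ha.1
  rw [labels, Finset.mem_union, Finset.mem_image, Finset.mem_image]
  rcases lt_trichotomy (letter N a) 0 with h | h | h
  · exact Or.inr ⟨start M a, Finset.mem_range.2 (by omega), by rw [label_of_neg M h, h1]⟩
  · omega
  · exact Or.inl ⟨start M a, Finset.mem_range.2 (by omega), by rw [label_of_pos M h, h1]⟩

theorem letter_neg_iff {N : Finset ℕ} {a : ℕ} (ha : 1 ≤ a) : letter N a < 0 ↔ a ∈ N := by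
  rw [letter]
  split_ifs with h
  · simp [h]
    omega
  · simp [h]

theorem card_filter_label_neg {n : ℕ} {M N : Finset ℕ} (hN : N ⊆ Finset.Icc 1 n) (s : ℕ) :
    ((letters n N).filter fun z => label M z = -((s : ℤ) + 1)).card =
      (N.filter fun a => start M a = s).card := by
  rw [letters, Finset.filter_image, Finset.card_image_of_injective _ (letter_injective N)]
  congr 1
  ext a
  rw [Finset.mem_filter, Finset.mem_filter]
  have h1 := natAbs_letter N a
  constructor
  · rintro ⟨h2, h3⟩
    have h4 := letter_neg_iff (N := N) (Finset.mem_Icc.1 h2).1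
    rw [← h4]
    rcases lt_trichotomy (letter N a) 0 with h | h | h
    · rw [label_of_neg M h, h1] at h3
      omega
    · rw [h] at h3; simp [label] at h3; omega
    · rw [label_of_pos M h] at h3
      omega
  · rintro ⟨h2, rfl⟩
    have h4 := (letter_neg_iff (N := N) (Finset.mem_Icc.1 (hN h2)).1).2 h2
    exact ⟨hN h2, by rw [label_of_neg M h4, h1]⟩

theorem card_filter_label_pos {n : ℕ} {M N : Finset ℕ} (hN : N ⊆ Finset.Icc 1 n) (s : ℕ) :
    ((letters n N).filter fun z => label M z = (s : ℤ) + 1).card =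
      blockCard n M s - (N.filter fun a => start M a = s).card := by
  rw [letters, Finset.filter_image, Finset.card_image_of_injective _ (letter_injective N),
    blockCard, ← Finset.card_sdiff_of_subset (Finset.filter_subset_filter _ hN)]
  congr 1
  ext a
  rw [Finset.mem_sdiff, Finset.mem_filter, Finset.mem_filter, Finset.mem_filter]
  have h1 := natAbs_letter N a
  constructor
  · rintro ⟨h2, h3⟩
    have h4 := letter_neg_iff (N := N) (Finset.mem_Icc.1 h2).1
    rw [← h4]
    rcases lt_trichotomy (letter N a) 0 with h | h | h
    · rw [label_of_neg M h] at h3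
      omega
    · rw [h] at h3; simp [label] at h3; omega
    · rw [label_of_pos M h, h1] at h3
      exact ⟨⟨h2, by omega⟩, fun h5 => absurd h5.1 (by omega)⟩
  · rintro ⟨⟨h2, h3⟩, h4⟩
    have h5 := letter_neg_iff (N := N) (Finset.mem_Icc.1 h2).1
    have h6 := (Finset.mem_Icc.1 h2).1
    have h7 : 0 < letter N a := by
      have : ¬ letter N a < 0 := fun h => h4 ⟨h5.1 h, h3⟩
      omega
    exact ⟨h2, by rw [label_of_pos M h7, h1, h3]⟩

theorem classFactorial_letters {K : Type*} [Field K] (q : K) {n : ℕ} {M N : Finset ℕ}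
    (hN : N ⊆ Finset.Icc 1 n) : classFactorial q (label M) (labels n) (letters n N) =
      ∏ s ∈ Finset.range n, (qFactorial q (N.filter fun a => start M a = s).card *
        qFactorial q (blockCard n M s - (N.filter fun a => start M a = s).card)) := by
  rw [classFactorial, labels, Finset.prod_union, Finset.prod_image, Finset.prod_image,
    mul_comm, ← Finset.prod_mul_distrib]
  · simp only [card_filter_label_neg hN, card_filter_label_pos hN]
  · intro a _ b _ h
    simpa using h
  · intro a _ b _ h
    simpa using h
  · rw [Finset.disjoint_left]
    intro z h1 h2
    rw [Finset.mem_image] at h1 h2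
    obtain ⟨a, -, rfl⟩ := h1
    obtain ⟨b, -, h⟩ := h2
    omega

end Blocks

/-! ### Signed permutations without inverse descents off `M`, as words -/

section Shuffles

variable {n : ℕ} {M : Finset ℕ}

/-- The `γ ∈ B_n` whose inverses have no descent at positions in `[n-1] \ M`. -/
def IsShuffle (M : Finset ℕ) (γ : Equiv.Perm (Pt n)) : Prop :=
  γ ∈ B n ∧ ∀ i, 1 ≤ i → i < n → i ∉ M → win γ⁻¹ i < win γ⁻¹ (i + 1)

/-- Along a block the values of `γ⁻¹` increase, so the negative ones come first. -/
theorem IsShuffle.isInitial_negSet {γ : Equiv.Perm (Pt n)} (h : IsShuffle M γ) :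
    IsInitial n M (negSet γ) := by
  refine ⟨Finset.filter_subset _ _, fun i h1 h2 h3 h4 => ?_⟩
  rw [mem_negSet] at h4 ⊢
  exact ⟨⟨h1, h2.le⟩, (h.2 i h1 h2 h3).trans h4.2⟩

theorem IsShuffle.win_lt {γ : Equiv.Perm (Pt n)} (h : IsShuffle M γ) {a b : ℕ} (ha : 1 ≤ a)
    (hab : a < b) (hb : b ≤ n) (hs : start M a = start M b) : win γ⁻¹ a < win γ⁻¹ b := by
  induction b, hab using Nat.le_induction with
  | base => exact h.2 a ha (by omega) (notMem_of_start_eq hs ha le_rfl (by omega))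
  | succ k hk ih =>
    have h1 := notMem_of_start_eq hs ha (show a ≤ k by omega) (by omega)
    rw [start_succ h1] at hs
    exact (ih (by omega) hs).trans (h.2 k (by omega) (by omega) h1)

theorem letter_negSet {γ : Equiv.Perm (Pt n)} (hγ : γ ∈ B n) {i : ℕ} (hi : 1 ≤ i ∧ i ≤ n) :
    letter (negSet γ) (win γ i).natAbs = win γ i := by
  have hb := win_bounds γ hi
  rw [letter]
  have hm := mem_negSet (γ := γ) (a := (win γ i).natAbs)
  rcases lt_or_gt_of_ne hb.1 with h | h
  · have := (win_inv_eq_neg hγ (a := (win γ i).natAbs) hi (by omega)).2 (by omega)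
    rw [if_pos (hm.2 (by omega))]
    omega
  · have := (win_inv_eq (γ := γ) (a := (win γ i).natAbs) hi (by omega)).2 (by omega)
    rw [if_neg (fun h' => absurd (hm.1 h').2 (by omega))]
    omega

theorem win_injOn (γ : Equiv.Perm (Pt n)) {i j : ℕ} (hi : 1 ≤ i ∧ i ≤ n) (hj : 1 ≤ j ∧ j ≤ n)
    (h : win γ i = win γ j) : i = j := by
  rw [win_of_mem _ hi, win_of_mem _ hj] at h
  have := congrArg Subtype.val (γ.injective (Subtype.ext h))
  simpa using this

theorem coe_revWord_win {γ : Equiv.Perm (Pt n)} (hγ : γ ∈ B n) :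
    (revWord (win γ) n : Multiset ℤ) = (letters n (negSet γ)).val := by
  have hnd : (revWord (win γ) n).Nodup := by
    rw [List.Nodup, pairwise_revWord]
    intro i j h1 h2 h3 h
    have := win_injOn γ (by omega) (by omega) h
    omega
  refine Multiset.eq_of_le_of_card_le ((Multiset.le_iff_subset (Multiset.coe_nodup.2 hnd)).2
    fun z hz => ?_) ?_
  · rw [Multiset.mem_coe, mem_revWord] at hz
    obtain ⟨i, h1, h2, rfl⟩ := hz
    have hb := win_bounds γ ⟨h1, h2⟩
    exact mem_letters.2 ⟨_, by omega, letter_negSet hγ ⟨h1, h2⟩⟩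
  · rw [Multiset.coe_card, length_revWord, ← Finset.card_def, card_letters]

/-- In a block `γ⁻¹` increases. Positive letters therefore occur in increasing order; for negative
letters the position is `-γ⁻¹(a)`, so larger absolute values come earlier, which is again increasing
order. -/
theorem IsShuffle.revWord_mem_words {γ : Equiv.Perm (Pt n)} (h : IsShuffle M γ) :
    revWord (win γ) n ∈ words (label M) (letters n (negSet γ)) := by
  refine mem_words.2 ⟨coe_revWord_win h.1, pairwise_revWord.2 fun i j h1 h2 h3 he => ?_⟩
  have hi : 1 ≤ i ∧ i ≤ n := by omega
  have hj : 1 ≤ j ∧ j ≤ n := by omega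
  have hbi := win_bounds γ hi
  have hbj := win_bounds γ hj
  have hne : win γ i ≠ win γ j := fun h4 => by
    have := win_injOn γ hi hj h4
    omega
  by_contra hlt
  have hlt' : win γ i < win γ j := by omega
  rcases lt_or_gt_of_ne hbi.1 with h4 | h4 <;> rcases lt_or_gt_of_ne hbj.1 with h5 | h5
  · rw [label_of_neg M h4, label_of_neg M h5] at he
    have e1 := (win_inv_eq_neg h.1 (a := (win γ i).natAbs) hi (by omega)).2 (by omega)
    have e2 := (win_inv_eq_neg h.1 (a := (win γ j).natAbs) hj (by omega)).2 (by omega)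
    have := h.win_lt (a := (win γ j).natAbs) (b := (win γ i).natAbs) (by omega) (by omega)
      (by omega) (by omega)
    omega
  · rw [label_of_neg M h4, label_of_pos M h5] at he
    omega
  · omega
  · rw [label_of_pos M h4, label_of_pos M h5] at he
    have e1 := (win_inv_eq (γ := γ) (a := (win γ i).natAbs) hi (by omega)).2 (by omega)
    have e2 := (win_inv_eq (γ := γ) (a := (win γ j).natAbs) hj (by omega)).2 (by omega)
    have := h.win_lt (a := (win γ i).natAbs) (b := (win γ j).natAbs) (by omega) (by omega)
      (by omega) (by omega)
    omega

theorem exists_win_eq {w : ℕ → ℤ} (hw : ∀ i, 1 ≤ i → i ≤ n → w i ≠ 0 ∧ -(n : ℤ) ≤ w i ∧ w i ≤ n)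
    (hinj : ∀ i j, 1 ≤ i → i ≤ n → 1 ≤ j → j ≤ n → (w i).natAbs = (w j).natAbs → i = j) :
    ∃ γ ∈ B n, ∀ i, 1 ≤ i → i ≤ n → win γ i = w i := by
  have hval : ∀ x : Pt n, Int.sign x.1 * w x.1.natAbs ≠ 0 ∧
      -(n : ℤ) ≤ Int.sign x.1 * w x.1.natAbs ∧ Int.sign x.1 * w x.1.natAbs ≤ n := by
    intro x
    have hx := x.2
    have := hw x.1.natAbs (by omega) (by omega)
    rcases lt_or_gt_of_ne x.2.1 with h | h
    · rw [Int.sign_eq_neg_one_of_neg h]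
      omega
    · rw [Int.sign_eq_one_of_pos h]
      omega
  let f : Pt n → Pt n := fun x => ⟨Int.sign x.1 * w x.1.natAbs, hval x⟩
  have hf : Function.Injective f := by
    intro x y h
    have hx := x.2
    have hy := y.2
    have h' : Int.sign x.1 * w x.1.natAbs = Int.sign y.1 * w y.1.natAbs := congrArg Subtype.val h
    have h1 : (w x.1.natAbs).natAbs = (w y.1.natAbs).natAbs := by
      have := congrArg Int.natAbs h'
      rwa [Int.natAbs_mul, Int.natAbs_mul, Int.natAbs_sign_of_ne_zero hx.1,
        Int.natAbs_sign_of_ne_zero hy.1, one_mul, one_mul] at this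
    have h2 := hinj _ _ (by omega) (by omega) (by omega) (by omega) h1
    have h3 := hw x.1.natAbs (by omega) (by omega)
    rw [← h2] at h'
    have h4 := mul_right_cancel₀ h3.1 h'
    apply Subtype.ext
    rw [← Int.sign_mul_natAbs x.1, ← Int.sign_mul_natAbs y.1, h4, h2]
  refine ⟨Equiv.ofBijective f (Finite.injective_iff_bijective.1 hf), fun x => ?_, fun i h1 h2 => ?_⟩
  · apply Subtype.ext
    simp [f, Equiv.ofBijective_apply]
  · rw [win_of_mem _ ⟨h1, h2⟩, Equiv.ofBijective_apply]
    have : 0 < (i : ℤ) := by omega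
    simp [f, Int.sign_eq_one_of_pos this]

theorem exists_isShuffle {N : Finset ℕ} (hN : IsInitial n M N) {l : List ℤ}
    (hl : l ∈ words (label M) (letters n N)) :
    ∃ γ : Equiv.Perm (Pt n), (IsShuffle M γ ∧ negSet γ = N) ∧ revWord (win γ) n = l := by
  have hlen := length_of_mem_words hl
  rw [card_letters] at hlen
  obtain ⟨w, hw⟩ := exists_revWord_eq l
  rw [hlen] at hw
  subst hw
  obtain ⟨h1, h2⟩ := mem_words.1 hl
  have hmem : ∀ i, 1 ≤ i → i ≤ n → ∃ a, (1 ≤ a ∧ a ≤ n) ∧ letter N a = w i := by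
    intro i h3 h4
    rw [← mem_letters, ← Finset.mem_val, ← h1, Multiset.mem_coe, mem_revWord]
    exact ⟨i, h3, h4, rfl⟩
  have hmem' : ∀ a, 1 ≤ a → a ≤ n → ∃ i, 1 ≤ i ∧ i ≤ n ∧ w i = letter N a := by
    intro a h3 h4
    rw [← mem_revWord, ← Multiset.mem_coe, h1, Finset.mem_val]
    exact mem_letters.2 ⟨a, ⟨h3, h4⟩, rfl⟩
  have hnd : (revWord w n).Nodup := by
    rw [← Multiset.coe_nodup, h1]
    exact Finset.nodup _
  rw [List.Nodup, pairwise_revWord] at hnd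
  have hinj : ∀ i j, 1 ≤ i → i ≤ n → 1 ≤ j → j ≤ n → (w i).natAbs = (w j).natAbs → i = j := by
    intro i j h3 h4 h5 h6 h7
    obtain ⟨a, -, ha⟩ := hmem i h3 h4
    obtain ⟨b, -, hb⟩ := hmem j h5 h6
    rw [← ha, ← hb, natAbs_letter, natAbs_letter] at h7
    rw [h7, hb] at ha
    rcases lt_trichotomy i j with h | h | h
    · exact absurd ha (hnd j i h3 h h6)
    · exact h
    · exact absurd ha.symm (hnd i j h5 h h4)
  obtain ⟨γ, hγ, hγw⟩ := exists_win_eq (n := n) (w := w) (fun i h3 h4 => by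
    obtain ⟨a, ha, h5⟩ := hmem i h3 h4
    have := natAbs_letter N a
    omega) hinj
  have hsign : ∀ a, 1 ≤ a → a ≤ n → ∃ i, (1 ≤ i ∧ i ≤ n) ∧
      ((a ∈ N ∧ w i = -a ∧ win γ⁻¹ a = -i) ∨ (a ∉ N ∧ w i = a ∧ win γ⁻¹ a = i)) := by
    intro a h3 h4
    obtain ⟨i, h5, h6, h7⟩ := hmem' a h3 h4
    refine ⟨i, ⟨h5, h6⟩, ?_⟩
    rw [letter] at h7
    split_ifs at h7 with h8
    · exact Or.inl ⟨h8, h7, (win_inv_eq_neg hγ ⟨h5, h6⟩ ⟨h3, h4⟩).2 (by rw [hγw i h5 h6, h7])⟩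
    · exact Or.inr ⟨h8, h7, (win_inv_eq ⟨h5, h6⟩ ⟨h3, h4⟩).2 (by rw [hγw i h5 h6, h7])⟩
  rw [pairwise_revWord] at h2
  refine ⟨γ, ⟨⟨hγ, fun i h3 h4 h5 => ?_⟩, ?_⟩, revWord_congr hγw⟩
  · have hs := start_succ h5
    obtain ⟨p, hp, hp'⟩ := hsign i h3 h4.le
    obtain ⟨r, hr, hr'⟩ := hsign (i + 1) (by omega) h4
    have hini := hN.2 i h3 h4 h5
    have hlab : w p < 0 ∧ w r < 0 ∨ 0 < w p ∧ 0 < w r → label M (w p) = label M (w r) := by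
      have e1 : (w p).natAbs = i := by omega
      have e2 : (w r).natAbs = i + 1 := by omega
      rintro (h | h)
      · rw [label_of_neg M h.1, label_of_neg M h.2, e1, e2, hs]
      · rw [label_of_pos M h.1, label_of_pos M h.2, e1, e2, hs]
    have hpr : p ≠ r := by
      rintro rfl
      omega
    rcases hp' with ⟨hp1, hp2, hp3⟩ | ⟨hp1, hp2, hp3⟩ <;>
      rcases hr' with ⟨hr1, hr2, hr3⟩ | ⟨hr1, hr2, hr3⟩
    · have hlab' := hlab (by omega)
      have : ¬ p < r := fun h => by
        have := h2 r p hp.1 h hr.2 hlab'.symm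
        omega
      omega
    · omega
    -- The letter `i` positive and `i + 1` negative: the only sign pattern that forces a descent of
    -- the inverse, excluded because `N` is initial.
    · exact absurd (hini hr1) hp1
    · have hlab' := hlab (by omega)
      have : ¬ r < p := fun h => by
        have := h2 p r hr.1 h hp.2 hlab'
        omega
      omega
  · ext a
    rw [mem_negSet]
    constructor
    · rintro ⟨h3, h4⟩
      obtain ⟨i, hi, h5 | h5⟩ := hsign a h3.1 h3.2
      · exact h5.1
      · omega
    · intro h3
      have h4 := Finset.mem_Icc.1 (hN.1 h3)
      obtain ⟨i, hi, h5 | h5⟩ := hsign a h4.1 h4.2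
      · exact ⟨h4, by omega⟩
      · exact absurd h3 h5.1

theorem eq_of_win_eq {γ δ : Equiv.Perm (Pt n)} (hγ : γ ∈ B n) (hδ : δ ∈ B n)
    (h : ∀ i, 1 ≤ i → i ≤ n → win γ i = win δ i) : γ = δ := by
  ext x
  have hx := x.2
  rw [win_natAbs hγ, win_natAbs hδ, h _ (by omega) (by omega)]

open Classical in
theorem sum_isShuffle {K : Type*} [Field K] {N : Finset ℕ} (hN : IsInitial n M N)
    (f : List ℤ → K) : ∑ γ : Equiv.Perm (Pt n) with IsShuffle M γ ∧ negSet γ = N,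
      f (revWord (win γ) n) = ∑ l ∈ words (label M) (letters n N), f l := by
  refine Finset.sum_bij (fun γ _ => revWord (win γ) n) ?_ ?_ ?_ ?_
  · intro γ hγ
    obtain ⟨h1, rfl⟩ := (Finset.mem_filter.1 hγ).2
    exact h1.revWord_mem_words
  · intro γ hγ δ hδ h
    exact eq_of_win_eq (Finset.mem_filter.1 hγ).2.1.1 (Finset.mem_filter.1 hδ).2.1.1
      fun i h1 h2 => eq_of_revWord_eq h h1 h2
  · intro l hl
    obtain ⟨γ, hγ, h⟩ := exists_isShuffle hN hl
    exact ⟨γ, Finset.mem_filter.2 ⟨Finset.mem_univ _, hγ⟩, h⟩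
  · intros
    rfl

end Shuffles

/-! ### The `q`-binomial theorem and the generating function over `B_n` -/

section Sums

variable {K : Type*} [Field K]

theorem qInt_zero (q : K) : qInt q 0 = 0 := by simp [qInt]

/-- The `q`-binomial theorem. -/
theorem sum_qBinomial {q : K} (hq : ∀ k, 1 ≤ k → qInt q k ≠ 0) (y : K) (c : ℕ) :
    ∑ r ∈ Finset.range (c + 1),
      (∏ j ∈ Finset.range r, y * q ^ j) / (qFactorial q r * qFactorial q (c - r)) =
      (∏ j ∈ Finset.range c, (1 + y * q ^ j)) / qFactorial q c := by
  have hF := qFactorial_ne_zero hq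
  induction c with
  | zero => simp [qFactorial_zero]
  | succ c ih =>
    rw [Finset.prod_range_succ, qFactorial_succ, mul_div_mul_comm, ← ih, ← mul_div_assoc,
      eq_div_iff (hq _ (by omega)), Finset.sum_mul]
    -- Splitting `[c+1] = [c+1-r] + q^(c+1-r) [r]` is the `q`-Pascal rule. The first part cancels
    -- into `[c+1-r]!`, the second into `[r]!`, and after a shift of `r` the latter yields the
    -- factor `y * q ^ c`.
    have h1 : ∀ r ∈ Finset.range (c + 1 + 1), (∏ j ∈ Finset.range r, y * q ^ j) /
        (qFactorial q r * qFactorial q (c + 1 - r)) * qInt q (c + 1) =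
        (∏ j ∈ Finset.range r, y * q ^ j) / (qFactorial q r * qFactorial q (c + 1 - r)) *
          qInt q (c + 1 - r) +
        (∏ j ∈ Finset.range r, y * q ^ j) / (qFactorial q r * qFactorial q (c + 1 - r)) *
          (q ^ (c + 1 - r) * qInt q r) := by
      intro r hr
      rw [← mul_add, ← qInt_add, Nat.sub_add_cancel (by have := Finset.mem_range.1 hr; omega)]
    rw [Finset.sum_congr rfl h1, Finset.sum_add_distrib, Finset.sum_range_succ,
      Finset.sum_range_succ' _ (c + 1), Nat.sub_self, qInt_zero, mul_zero, mul_zero, mul_zero,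
      add_zero, add_zero, mul_add, mul_one, Finset.sum_mul]
    congr 1
    · refine Finset.sum_congr rfl fun r hr => ?_
      have hr' := Finset.mem_range.1 hr
      rw [show c + 1 - r = c - r + 1 by omega, qFactorial_succ]
      have h2 := hq (c - r + 1) (by omega)
      have h3 := hF r
      have h4 := hF (c - r)
      field_simp
    · refine Finset.sum_congr rfl fun r hr => ?_
      have hr' := Finset.mem_range.1 hr
      rw [show c + 1 - (r + 1) = c - r by omega, qFactorial_succ, Finset.prod_range_succ]
      have h2 := hq (r + 1) (by omega)
      have h3 := hF r
      have h4 := hF (c - r)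
      have h5 : q ^ c = q ^ (c - r) * q ^ r := by rw [← pow_add]; congr 1; omega
      rw [h5]
      field_simp

-- An initial set is determined by the number of letters it takes from each block, and these numbers
-- can be chosen independently.
open Classical in
theorem sum_isInitial (n : ℕ) (M : Finset ℕ) (f : ℕ → ℕ → K) :
    ∑ N ∈ (Finset.Icc 1 n).powerset with IsInitial n M N,
      ∏ s ∈ Finset.range n, f s (N.filter fun a => start M a = s).card =
    ∏ s ∈ Finset.range n, ∑ r ∈ Finset.range (blockCard n M s + 1), f s r := by
  rw [Finset.prod_range, Finset.prod_univ_sum]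
  let ext : (Fin n → ℕ) → ℕ → ℕ := fun r s => if h : s < n then r ⟨s, h⟩ else 0
  let J : (Fin n → ℕ) → Finset ℕ := fun r =>
    (Finset.Icc 1 n).filter fun a => a ≤ start M a + ext r (start M a)
  have hext : ∀ (r : Fin n → ℕ) (s : Fin n), ext r s = r s := fun r s => by simp [ext]
  have hJ : ∀ r, IsInitial n M (J r) := by
    refine fun r => ⟨Finset.filter_subset _ _, fun i h1 h2 h3 h4 => ?_⟩
    obtain ⟨h5, h6⟩ := Finset.mem_filter.1 h4
    rw [start_succ h3] at h6
    exact Finset.mem_filter.2 ⟨Finset.mem_Icc.2 ⟨h1, h2.le⟩, by omega⟩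
  refine Finset.sum_bij' (fun N _ s => (N.filter fun a => start M a = s).card)
    (fun r _ => J r) ?_ ?_ ?_ ?_ ?_
  · intro N hN
    rw [Fintype.mem_piFinset]
    intro s
    rw [Finset.mem_range, Nat.lt_succ_iff]
    exact Finset.card_le_card
      (Finset.filter_subset_filter _ (Finset.mem_filter.1 hN).2.1)
  · intro r hr
    exact Finset.mem_filter.2 ⟨Finset.mem_powerset.2 (hJ r).1, hJ r⟩
  · intro N hN
    have hN' := (Finset.mem_filter.1 hN).2
    ext a
    simp only [J, Finset.mem_filter, Finset.mem_Icc]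
    constructor
    · rintro ⟨h1, h2⟩
      have h3 := start_lt (M := M) h1.1
      have h4 := hext (fun s => (N.filter fun a => start M a = s).card) ⟨start M a, by omega⟩
      dsimp only at h4
      rw [h4] at h2
      have h5 : a ∈ N.filter fun b => start M b = start M a := by
        rw [hN'.filter_start]
        exact Finset.mem_Ioc.2 ⟨h3, h2⟩
      exact (Finset.mem_filter.1 h5).1
    · intro h
      have h1 := Finset.mem_Icc.1 (hN'.1 h)
      refine ⟨h1, ?_⟩
      have h3 := start_lt (M := M) h1.1
      have h4 := hext (fun s => (N.filter fun a => start M a = s).card) ⟨start M a, by omega⟩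
      dsimp only at h4
      rw [h4]
      have h5 : a ∈ N.filter fun b => start M b = start M a := Finset.mem_filter.2 ⟨h, rfl⟩
      rw [hN'.filter_start] at h5
      exact (Finset.mem_Ioc.1 h5).2
  · intro r hr
    funext s
    have h1 := Finset.mem_range.1 (Fintype.mem_piFinset.1 hr s)
    have h2 : (J r).filter (fun a => start M a = s) = Finset.Ioc (s : ℕ) (s + r s) := by
      have h3 : (J r).filter (fun a => start M a = s) =
          ((Finset.Icc 1 n).filter fun a => start M a = s).filter fun a => a ≤ s + r s := by
        ext a
        simp only [J, Finset.mem_filter]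
        constructor
        · rintro ⟨⟨h4, h5⟩, h6⟩
          rw [h6, hext] at h5
          exact ⟨⟨h4, h6⟩, h5⟩
        · rintro ⟨⟨h4, h6⟩, h5⟩
          refine ⟨⟨h4, ?_⟩, h6⟩
          rwa [h6, hext]
      rw [h3, filter_start_eq_Ioc]
      ext a
      simp only [Finset.mem_filter, Finset.mem_Ioc]
      omega
    simp [h2]
  · intro N hN
    rw [Finset.prod_range]

theorem prod_by_start {n : ℕ} {M N : Finset ℕ} (hN : IsInitial n M N) (g : ℕ → ℕ → K) :
    ∏ a ∈ N, g (start M a) (a - 1) = ∏ s ∈ Finset.range n,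
      ∏ j ∈ Finset.range (N.filter fun a => start M a = s).card, g s (s + j) := by
  rw [← Finset.prod_fiberwise_of_maps_to (s := N) (t := Finset.range n) (g := start M)]
  · refine Finset.prod_congr rfl fun s _ => ?_
    have h : ∏ a ∈ N with start M a = s, g (start M a) (a - 1) =
        ∏ a ∈ N with start M a = s, g s (a - 1) :=
      Finset.prod_congr rfl fun a ha => by rw [(Finset.mem_filter.1 ha).2]
    rw [h, hN.filter_start s]
    generalize (N.filter fun a => start M a = s).card = k
    rw [Nat.card_Ioc, Nat.add_sub_cancel_left, Finset.range_eq_Ico,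
      Finset.prod_Ico_add (fun i => g s i) 0 k s, zero_add, add_comm k s,
      ← Finset.Ico_add_one_add_one_eq_Ioc, ← Finset.prod_Ico_add' _ s (s + k) 1]
    simp
  · intro a ha
    have h1 := Finset.mem_Icc.1 (hN.1 ha)
    have := start_lt (M := M) h1.1
    exact Finset.mem_range.2 (by omega)

/-- The generating function of `stat` over the arrangements of an alphabet whose letters with
equal labels increase is a `q`-multinomial coefficient. -/
def IsMahonian (q : K) (stat : List ℤ → ℕ) : Prop :=
  ∀ (β : ℤ → ℤ) (T A : Finset ℤ), MonotoneOn β A → (∀ z ∈ A, β z ∈ T) →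
    (∑ l ∈ words β A, q ^ stat l) * classFactorial q β T A = qFactorial q A.card

theorem isMahonian_revMaj (q : K) : IsMahonian q revMaj :=
  fun _ _ A h1 h2 => sum_words_revMaj A h1 h2

theorem isMahonian_revInv (q : K) : IsMahonian q revInv :=
  fun _ _ A h1 h2 => sum_words_revInv A.card A rfl h1 h2

/-- The statistic on signed permutations induced by a statistic on words. -/
noncomputable def signedStat {n : ℕ} (stat : List ℤ → ℕ) (γ : Equiv.Perm (Pt n)) : ℕ :=
  stat (revWord (win γ) n) + ∑ a ∈ negSet γ, (a - 1)

-- For a fixed negative set the Mahonian property gives `[n]_q!` over the class factorials. The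
-- negative letters of the block after `s` are `s + 1, s + 2, …`, with weights `X s * q ^ (s + j)`,
-- so the sum over their number is the `q`-binomial theorem with `y = X s * q ^ s`.
open Classical in
theorem sum_signedStat {q : K} (hq : ∀ k, 1 ≤ k → qInt q k ≠ 0) {stat : List ℤ → ℕ}
    (hs : IsMahonian q stat) (n : ℕ) (M : Finset ℕ) (X : ℕ → K) :
    ∑ γ : Equiv.Perm (Pt n) with IsShuffle M γ,
      (∏ a ∈ negSet γ, X (start M a)) * q ^ signedStat stat γ =
    qFactorial q n * (∏ a ∈ Finset.Icc 1 n, (1 + X (start M a) * q ^ (a - 1))) /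
      ∏ s ∈ Finset.range n, qFactorial q (blockCard n M s) := by
  have hF := qFactorial_ne_zero hq
  have hmaps : ∀ γ ∈ (Finset.univ.filter fun γ : Equiv.Perm (Pt n) => IsShuffle M γ),
      negSet γ ∈ (Finset.Icc 1 n).powerset.filter fun N => IsInitial n M N := by
    intro γ hγ
    have := (Finset.mem_filter.1 hγ).2.isInitial_negSet
    exact Finset.mem_filter.2 ⟨Finset.mem_powerset.2 this.1, this⟩
  rw [← Finset.sum_fiberwise_of_maps_to hmaps]
  have hterm : ∀ N ∈ (Finset.Icc 1 n).powerset.filter fun N => IsInitial n M N,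
      ∑ γ ∈ (Finset.univ.filter fun γ : Equiv.Perm (Pt n) => IsShuffle M γ) with negSet γ = N,
        (∏ a ∈ negSet γ, X (start M a)) * q ^ signedStat stat γ =
      qFactorial q n * ∏ s ∈ Finset.range n,
        (∏ j ∈ Finset.range (N.filter fun a => start M a = s).card, X s * q ^ s * q ^ j) /
          (qFactorial q (N.filter fun a => start M a = s).card *
            qFactorial q (blockCard n M s - (N.filter fun a => start M a = s).card)) := by
    intro N hN
    have hN' := (Finset.mem_filter.1 hN).2
    have h1 : ∀ γ ∈ (Finset.univ.filter fun γ : Equiv.Perm (Pt n) => IsShuffle M γ).filter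
        (fun γ => negSet γ = N), (∏ a ∈ negSet γ, X (start M a)) * q ^ signedStat stat γ =
          (∏ a ∈ N, X (start M a) * q ^ (a - 1)) * q ^ stat (revWord (win γ) n) := by
      intro γ hγ
      rw [signedStat, (Finset.mem_filter.1 hγ).2, Finset.prod_mul_distrib,
        Finset.prod_pow_eq_pow_sum, pow_add]
      ring
    rw [Finset.sum_congr rfl h1, ← Finset.mul_sum, Finset.filter_filter,
      sum_isShuffle hN' (fun l => q ^ stat l), prod_by_start hN' (fun s i => X s * q ^ i),
      Finset.prod_div_distrib, ← classFactorial_letters q hN'.1]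
    have h2 := hs (label M) (labels n) (letters n N) ((label_mono M).monotoneOn _)
      (fun z hz => label_mem_labels hz)
    rw [card_letters] at h2
    have h3 : classFactorial q (label M) (labels n) (letters n N) ≠ 0 :=
      Finset.prod_ne_zero_iff.2 fun _ _ => hF _
    rw [← mul_div_assoc, eq_div_iff h3, mul_assoc, h2, mul_comm]
    simp only [pow_add, mul_assoc]
  rw [Finset.sum_congr rfl hterm, ← Finset.mul_sum,
    sum_isInitial n M fun s r => (∏ j ∈ Finset.range r, X s * q ^ s * q ^ j) /
      (qFactorial q r * qFactorial q (blockCard n M s - r)),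
    Finset.prod_congr rfl fun s _ => sum_qBinomial hq (X s * q ^ s) (blockCard n M s),
    Finset.prod_div_distrib, ← mul_div_assoc,
    prod_by_start (isInitial_Icc n M) (fun s i => 1 + X s * q ^ i)]
  simp only [pow_add, mul_assoc]
  rfl

theorem start_insert {M : Finset ℕ} {m : ℕ} (h : ∀ x ∈ M, x < m) (a : ℕ) :
    start (insert m M) a = if a ≤ m then start M a else m := by
  split_ifs with h1
  · rw [start, start, Finset.filter_insert, if_neg (by omega)]
  · refine le_antisymm (Finset.sup_le fun x hx => ?_) (le_start (Finset.mem_insert_self _ _)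
      (by omega))
    rcases Finset.mem_insert.1 (Finset.mem_filter.1 hx).1 with rfl | h2
    · exact le_rfl
    · exact (h x h2).le

theorem sort_insert_max {M : Finset ℕ} {m : ℕ} (h : ∀ x ∈ M, x < m) :
    (insert m M).sort = M.sort ++ [m] := by
  have hS : ∀ x ∈ M.sort, x < m := fun x hx => h x ((Finset.mem_sort _).1 hx)
  have h1 : (M.sort ++ [m]).Nodup := by
    rw [List.nodup_append']
    refine ⟨Finset.sort_nodup _ _, List.nodup_singleton m, fun x hx hx' => ?_⟩
    rw [List.mem_singleton] at hx'
    exact (hS x hx).ne hx'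
  have h2 : (M.sort ++ [m]).toFinset = insert m M := by
    ext x
    simp
  rw [← h2, List.toFinset_sort _ h1, List.pairwise_append]
  refine ⟨Finset.pairwise_sort _ _, List.pairwise_singleton _ _, fun x hx y hy => ?_⟩
  rw [List.mem_singleton] at hy
  exact hy ▸ (hS x hx).le

theorem zipWith_sub_append (s m n : ℕ) (S : List ℕ) :
    List.zipWith (fun a b => b - a) (s :: (S ++ [m] ++ [n])) (S ++ [m] ++ [n]) =
      List.zipWith (fun a b => b - a) (s :: (S ++ [m])) (S ++ [m]) ++ [n - m] := by
  induction S generalizing s with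
  | nil => simp
  | cons x S ih =>
    have := ih x
    simp only [List.cons_append, List.zipWith_cons_cons] at this ⊢
    rw [this]

/-- Adding a new maximum `m` to `M` cuts the last block at `m`. The product on the right runs over
every `s < n`, but an `s > 0` outside `M` begins no block and contributes `[0]_q! = 1`. -/
theorem prod_parts (q : K) {n : ℕ} {M : Finset ℕ} (hM : M ⊆ Finset.range n) :
    ((parts n M).map (qFactorial q)).prod =
      ∏ s ∈ Finset.range n, qFactorial q (blockCard n M s) := by
  induction M using Finset.induction_on_max generalizing n with
  | empty =>
    have h : ∀ s, blockCard n ∅ s = if s = 0 then n else 0 := by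
      intro s
      rw [blockCard]
      split_ifs with h0
      · subst h0
        rw [Finset.filter_true_of_mem (by simp [start])]
        simp
      · rw [Finset.card_eq_zero, Finset.filter_eq_empty_iff]
        intro a _ ha
        exact h0 (by simpa [start] using ha.symm)
    -- The case `n = 0` is reached from the inductive step when the inserted maximum is `0`.
    rcases n with _ | n
    · simp [parts, elems, qFactorial_zero]
    · rw [Finset.prod_range_succ']
      simp [parts, elems, h, qFactorial_zero]
  | insert m M hm ih =>
    have hmn : m < n := Finset.mem_range.1 (hM (Finset.mem_insert_self _ _))
    have h1 : parts n (insert m M) = parts m M ++ [n - m] := by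
      rw [parts, parts, elems, elems, sort_insert_max hm, zipWith_sub_append]
    rw [h1, List.map_append, List.prod_append, ih fun x hx => Finset.mem_range.2 (hm x hx),
      ← Finset.prod_range_mul_prod_Ico _ hmn.le, Finset.prod_eq_prod_Ico_succ_bot hmn]
    congr 1
    · refine Finset.prod_congr rfl fun s hs => ?_
      have hs' := Finset.mem_range.1 hs
      rw [blockCard, blockCard]
      congr 2
      ext a
      rw [Finset.mem_filter, Finset.mem_filter, Finset.mem_Icc, Finset.mem_Icc, start_insert hm]
      split_ifs with h2 <;> omega
    · have h3 : blockCard n (insert m M) m = n - m := by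
        have : ((Finset.Icc 1 n).filter fun a => start (insert m M) a = m) =
            Finset.Ioc m n := by
          ext a
          rw [Finset.mem_filter, Finset.mem_Icc, Finset.mem_Ioc, start_insert hm]
          split_ifs with h2
          · constructor
            · rintro ⟨h4, h5⟩
              have := start_lt (M := M) h4.1
              omega
            · omega
          · omega
        rw [blockCard, this, Nat.card_Ioc]
      have h4 : ∀ s ∈ Finset.Ico (m + 1) n, qFactorial q (blockCard n (insert m M) s) = 1 := by
        intro s hs
        have hs' := Finset.mem_Ico.1 hs
        have : blockCard n (insert m M) s = 0 := by
          rw [blockCard, Finset.card_eq_zero, Finset.filter_eq_empty_iff]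
          intro a ha
          rw [start_insert hm]
          have ha' := Finset.mem_Icc.1 ha
          split_ifs with h2
          · have := start_lt (M := M) ha'.1
            omega
          · omega
        rw [this, qFactorial_zero]
      rw [h3, Finset.prod_congr rfl h4]
      simp

end Sums

/-! ### Changing the sign of the letter `±1` -/

section Flip

variable {n : ℕ}

/-- `stat` depends only on the relative order of the letters. -/
def IsOrderInvariant (stat : List ℤ → ℕ) : Prop :=
  ∀ (w w' : ℕ → ℤ) (n : ℕ), (∀ i j, 1 ≤ i → i ≤ n → 1 ≤ j → j ≤ n → (w i < w j ↔ w' i < w' j)) →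
    stat (revWord w n) = stat (revWord w' n)

theorem isOrderInvariant_revInv : IsOrderInvariant revInv := by
  intro w w' n h
  rw [revInv_revWord, revInv_revWord]
  refine Finset.sum_congr rfl fun j hj => ?_
  have hj' := Finset.mem_Icc.1 hj
  congr 1
  refine Finset.filter_congr fun i hi => ?_
  have hi' := Finset.mem_Icc.1 hi
  exact h j i (by omega) (by omega) (by omega) (by omega)

theorem isOrderInvariant_revMaj : IsOrderInvariant revMaj := by
  intro w w' n h
  rw [revMaj_revWord, revMaj_revWord]
  congr 1
  refine Finset.filter_congr fun i hi => ?_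
  have hi' := Finset.mem_Ico.1 hi
  exact h _ _ (by omega) (by omega) (by omega) (by omega)

/-- The signed permutation `[-1, 2, …, n]`. -/
def flipOne (hn : 1 ≤ n) : Equiv.Perm (Pt n) := Equiv.swap (pt 1 ⟨le_rfl, hn⟩) (-pt 1 ⟨le_rfl, hn⟩)

theorem coe_flipOne (hn : 1 ≤ n) (x : Pt n) :
    (flipOne hn x).1 = if x.1.natAbs = 1 then -x.1 else x.1 := by
  have hx := x.2
  rw [flipOne, coe_swap, coe_neg, coe_pt]
  split_ifs <;> omega

theorem flipOne_mul_self (hn : 1 ≤ n) : flipOne hn * flipOne hn = 1 := Equiv.swap_mul_self _ _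

theorem flipOne_mem_B (hn : 1 ≤ n) : flipOne hn ∈ B n := by
  intro x
  apply Subtype.ext
  rw [coe_neg, coe_flipOne, coe_flipOne, coe_neg, Int.natAbs_neg]
  split_ifs <;> rfl

theorem flipOne_mul_flipOne_mul (hn : 1 ≤ n) (γ : Equiv.Perm (Pt n)) :
    flipOne hn * (flipOne hn * γ) = γ := by
  rw [← mul_assoc, flipOne_mul_self, one_mul]

theorem win_flipOne_mul (hn : 1 ≤ n) (γ : Equiv.Perm (Pt n)) {i : ℕ} (hi : 1 ≤ i ∧ i ≤ n) :
    win (flipOne hn * γ) i = if (win γ i).natAbs = 1 then -win γ i else win γ i := by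
  rw [win_of_mem _ hi, win_of_mem _ hi, Equiv.Perm.mul_apply, coe_flipOne]

theorem win_inv_flipOne_mul_one (hn : 1 ≤ n) {γ : Equiv.Perm (Pt n)} (hγ : γ ∈ B n) :
    win (flipOne hn * γ)⁻¹ 1 = -win γ⁻¹ 1 := by
  have hγ' : ∀ x, γ⁻¹ (-x) = -γ⁻¹ x := inv_mem hγ
  have h1 : (flipOne hn)⁻¹ = flipOne hn := inv_eq_of_mul_eq_one_left (flipOne_mul_self hn)
  rw [mul_inv_rev, h1, win_of_mem _ ⟨le_rfl, hn⟩, win_of_mem _ ⟨le_rfl, hn⟩, Equiv.Perm.mul_apply,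
    flipOne, Equiv.swap_apply_left, hγ', coe_neg]

theorem win_inv_flipOne_mul (hn : 1 ≤ n) (γ : Equiv.Perm (Pt n)) {a : ℕ} (ha : 2 ≤ a) :
    win (flipOne hn * γ)⁻¹ a = win γ⁻¹ a := by
  have h1 : (flipOne hn)⁻¹ = flipOne hn := inv_eq_of_mul_eq_one_left (flipOne_mul_self hn)
  rw [mul_inv_rev, h1]
  by_cases hb : 1 ≤ a ∧ a ≤ n
  · rw [win_of_mem _ hb, win_of_mem _ hb, Equiv.Perm.mul_apply]
    congr 2
    apply Subtype.ext
    rw [coe_flipOne, coe_pt, if_neg (by omega)]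
  · rw [win, win, dif_neg hb, dif_neg hb]

theorem erase_negSet_flipOne_mul (hn : 1 ≤ n) (γ : Equiv.Perm (Pt n)) :
    (negSet (flipOne hn * γ)).erase 1 = (negSet γ).erase 1 := by
  ext a
  rw [Finset.mem_erase, Finset.mem_erase, mem_negSet, mem_negSet]
  refine and_congr_right fun h1 => and_congr_right fun h2 => ?_
  rw [win_inv_flipOne_mul hn γ (by omega)]

theorem one_mem_negSet_flipOne_mul (hn : 1 ≤ n) {γ : Equiv.Perm (Pt n)} (hγ : γ ∈ B n) :
    1 ∈ negSet (flipOne hn * γ) ↔ 1 ∉ negSet γ := by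
  rw [mem_negSet, mem_negSet, win_inv_flipOne_mul_one hn hγ]
  have := win_bounds γ⁻¹ ⟨le_rfl, hn⟩
  omega

theorem even_negSet_flipOne_mul (hn : 1 ≤ n) {γ : Equiv.Perm (Pt n)} (hγ : γ ∈ B n) :
    Even (negSet (flipOne hn * γ)).card ↔ ¬ Even (negSet γ).card := by
  have h1 := erase_negSet_flipOne_mul hn γ
  have h2 := one_mem_negSet_flipOne_mul hn hγ
  by_cases h : 1 ∈ negSet γ
  · rw [← Finset.card_erase_add_one h, ← h1, Finset.erase_eq_of_notMem (by tauto), Nat.even_add_one,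
      not_not]
  · rw [← Finset.card_erase_add_one (h2.2 h), h1, Finset.erase_eq_of_notMem h, Nat.even_add_one]

/-- No other letter lies between `-1` and `1`, so the relative order of the window is unchanged, and
the letter `1` contributes `1 - 1 = 0` to the sum over negative letters. -/
theorem signedStat_flipOne_mul {stat : List ℤ → ℕ} (hs : IsOrderInvariant stat) (hn : 1 ≤ n)
    {γ : Equiv.Perm (Pt n)} (hγ : γ ∈ B n) :
    signedStat stat (flipOne hn * γ) = signedStat stat γ := by
  rw [signedStat, signedStat]
  congr 1
  · refine hs _ _ n fun i j h1 h2 h3 h4 => ?_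
    rw [win_flipOne_mul hn γ ⟨h1, h2⟩, win_flipOne_mul hn γ ⟨h3, h4⟩]
    have hi := win_bounds γ ⟨h1, h2⟩
    have hj := win_bounds γ ⟨h3, h4⟩
    rcases eq_or_ne i j with rfl | hij
    · simp
    · have h5 : (win γ i).natAbs ≠ (win γ j).natAbs := by
        intro h
        have e2 := letter_negSet hγ ⟨h1, h2⟩
        rw [h, letter_negSet hγ ⟨h3, h4⟩] at e2
        exact hij (win_injOn γ ⟨h1, h2⟩ ⟨h3, h4⟩ e2.symm)
      split_ifs <;> omega
  · have h (N : Finset ℕ) : ∑ a ∈ N.erase 1, (a - 1) = ∑ a ∈ N, (a - 1) :=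
      Finset.sum_erase N (f := fun a => a - 1) rfl
    rw [← h (negSet γ), ← erase_negSet_flipOne_mul hn γ, h]

/-- The set `negSet γ` counts negative entries of the inverse, hence the passage through `N₁ γ⁻¹`
and closure of `D n` under inverses. -/
theorem mem_D_iff {γ : Equiv.Perm (Pt n)} : γ ∈ D n ↔ γ ∈ B n ∧ Even (negSet γ).card := by
  have hcard : N₁ γ⁻¹ = (negSet γ).card := by
    rw [N₁]
    refine Finset.card_bij (fun x _ => x.1.natAbs) ?_ ?_ ?_
    · intro x hx
      have hx' := x.2
      obtain ⟨-, h1, h2⟩ := Finset.mem_filter.1 hx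
      rw [mem_negSet, ← coe_apply_of_pos _ h1]
      exact ⟨by omega, h2⟩
    · intro x hx y hy h
      obtain ⟨-, h1, -⟩ := Finset.mem_filter.1 hx
      obtain ⟨-, h2, -⟩ := Finset.mem_filter.1 hy
      exact Subtype.ext (by omega)
    · intro a ha
      obtain ⟨h1, h2⟩ := mem_negSet.1 ha
      rw [win_of_mem _ h1] at h2
      exact ⟨pt a h1, Finset.mem_filter.2 ⟨Finset.mem_univ _, by rw [coe_pt]; omega, h2⟩, by simp⟩
  rw [← hcard]
  exact ⟨fun h => ⟨h.1, ((D n).inv_mem h).2⟩,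
    fun h => (inv_mem_iff (H := D n)).1 ⟨(B n).inv_mem h.1, h.2⟩⟩

theorem not_isDesc_iff {g : Equiv.Perm (Pt n)} {i : ℕ} (h1 : 1 ≤ i) (h2 : i < n) :
    ¬ IsDesc g i ↔ win g i < win g (i + 1) := by
  rw [IsDesc, if_neg (by omega), not_lt]
  refine ⟨fun h => lt_of_le_of_ne h fun he => ?_, le_of_lt⟩
  have := win_injOn g (i := i) (j := i + 1) (by omega) (by omega) he
  omega

theorem not_isDesc_zero_iff {g : Equiv.Perm (Pt n)} (hg : g ∈ B n) (h2 : 2 ≤ n) :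
    ¬ IsDesc g 0 ↔ 0 < win g 1 + win g 2 := by
  have h : win g 1 + win g 2 ≠ 0 := by
    rw [win_of_mem _ (by omega), win_of_mem _ (by omega)]
    exact ne_of_B hg (by simp)
  rw [IsDesc, if_pos rfl]
  omega

/-- Membership in the descent class `D(M)`, read off from the window of the inverse. -/
def InClass (M : Finset ℕ) (γ : Equiv.Perm (Pt n)) : Prop :=
  γ ∈ B n ∧ Even (negSet γ).card ∧
    (∀ i, 1 ≤ i → i < n → i ∉ M → win γ⁻¹ i < win γ⁻¹ (i + 1)) ∧
    (2 ≤ n → 0 ∉ M → 0 < win γ⁻¹ 1 + win γ⁻¹ 2)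

theorem mem_descentClass {M : Finset ℕ} {γ : D n} : γ ∈ descentClass n M ↔ InClass M γ.1 := by
  have hγ := γ.2.1
  have hγ' : γ.1⁻¹ ∈ B n := inv_mem hγ
  rw [descentClass, Finset.mem_filter]
  constructor
  · rintro ⟨-, h⟩
    have h' : ∀ i < n, i ∉ M → ¬ IsDesc γ.1⁻¹ i := fun i hi hM hd =>
      hM (h ((mem_DesD γ⁻¹ i).2 ⟨hi, hd⟩))
    exact ⟨hγ, (mem_D_iff.1 γ.2).2, fun i h1 h2 h3 => (not_isDesc_iff h1 h2).1 (h' i h2 h3),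
      fun h2 h3 => (not_isDesc_zero_iff hγ' h2).1 (h' 0 (by omega) h3)⟩
  · rintro ⟨-, -, h1, h2⟩
    refine ⟨Finset.mem_univ _, fun i hi => ?_⟩
    obtain ⟨h3, h4⟩ := (mem_DesD γ⁻¹ i).1 hi
    have h4' : IsDesc γ.1⁻¹ i := h4
    by_contra h5
    rcases Nat.eq_zero_or_pos i with rfl | h6
    · rcases lt_or_ge n 2 with h7 | h7
      · rw [IsDesc, if_pos rfl] at h4'
        omega
      · exact (not_isDesc_zero_iff hγ' h7).2 (h2 h7 h5) h4'
    · exact (not_isDesc_iff h6 h3).2 (h1 i h6 h3 h5) h4'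

end Flip

/-! ### The three cases of the product formula -/

section Main

variable {K : Type*} [Field K] {n : ℕ}

open Classical in
theorem sum_descentClass (M : Finset ℕ) (f : Equiv.Perm (Pt n) → K) :
    ∑ γ ∈ descentClass n M, f γ.1 = ∑ γ : Equiv.Perm (Pt n) with InClass M γ, f γ := by
  refine Finset.sum_bij (fun γ _ => γ.1) ?_ ?_ ?_ ?_
  · exact fun γ hγ => Finset.mem_filter.2 ⟨Finset.mem_univ _, mem_descentClass.1 hγ⟩
  · exact fun γ _ δ _ h => Subtype.ext h
  · intro γ hγ
    have h := (Finset.mem_filter.1 hγ).2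
    exact ⟨⟨γ, mem_D_iff.2 ⟨h.1, h.2.1⟩⟩, mem_descentClass.2 h, rfl⟩
  · intros
    rfl

-- The weights `X = 1` and `X = -1` give the sum and the difference of the two parities. The
-- difference is zero, since its factor at `a = 1` is `1 - q^0`; the factor at `a = 1` in the sum is
-- `2`, and it cancels.
open Classical in
theorem sum_isShuffle_parity [CharZero K] {q : K} (hq : ∀ k, 1 ≤ k → qInt q k ≠ 0)
    {stat : List ℤ → ℕ} (hs : IsMahonian q stat) (hn : 1 ≤ n) (M : Finset ℕ) :
    (∑ γ : Equiv.Perm (Pt n) with IsShuffle M γ ∧ Even (negSet γ).card, q ^ signedStat stat γ =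
      qFactorial q n * (∏ i ∈ Finset.Ico 1 n, (1 + q ^ i)) /
        ∏ s ∈ Finset.range n, qFactorial q (blockCard n M s)) ∧
    (∑ γ : Equiv.Perm (Pt n) with IsShuffle M γ ∧ ¬ Even (negSet γ).card, q ^ signedStat stat γ =
      qFactorial q n * (∏ i ∈ Finset.Ico 1 n, (1 + q ^ i)) /
        ∏ s ∈ Finset.range n, qFactorial q (blockCard n M s)) := by
  have h1 := sum_signedStat hq hs n M (fun _ => 1)
  have h2 := sum_signedStat hq hs n M (fun _ => -1)
  have e1 : ∏ a ∈ Finset.Icc 1 n, (1 + 1 * q ^ (a - 1)) =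
      2 * ∏ i ∈ Finset.Ico 1 n, (1 + q ^ i) := by
    rw [← Finset.Ico_add_one_right_eq_Icc, ← Finset.prod_Ico_add' _ 0 n 1,
      Finset.prod_eq_prod_Ico_succ_bot (by omega)]
    simp
    norm_num
  have e2 : ∏ a ∈ Finset.Icc 1 n, (1 + -1 * q ^ (a - 1)) = 0 :=
    Finset.prod_eq_zero (Finset.mem_Icc.2 ⟨le_rfl, hn⟩) (by simp)
  rw [e1, ← Finset.sum_filter_add_sum_filter_not _
    (fun γ : Equiv.Perm (Pt n) => Even (negSet γ).card), Finset.filter_filter,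
    Finset.filter_filter] at h1
  rw [e2, ← Finset.sum_filter_add_sum_filter_not _
    (fun γ : Equiv.Perm (Pt n) => Even (negSet γ).card), Finset.filter_filter,
    Finset.filter_filter, mul_zero, zero_div] at h2
  have h3 : ∑ γ : Equiv.Perm (Pt n) with IsShuffle M γ ∧ Even (negSet γ).card,
      (∏ a ∈ negSet γ, (-1 : K)) * q ^ signedStat stat γ =
      ∑ γ : Equiv.Perm (Pt n) with IsShuffle M γ ∧ Even (negSet γ).card,
        q ^ signedStat stat γ := by
    refine Finset.sum_congr rfl fun γ hγ => ?_
    rw [Finset.prod_const, (Finset.mem_filter.1 hγ).2.2.neg_one_pow, one_mul]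
  have h4 : ∑ γ : Equiv.Perm (Pt n) with IsShuffle M γ ∧ ¬ Even (negSet γ).card,
      (∏ a ∈ negSet γ, (-1 : K)) * q ^ signedStat stat γ =
      -∑ γ : Equiv.Perm (Pt n) with IsShuffle M γ ∧ ¬ Even (negSet γ).card,
        q ^ signedStat stat γ := by
    rw [← Finset.sum_neg_distrib]
    refine Finset.sum_congr rfl fun γ hγ => ?_
    rw [Finset.prod_const, (Nat.not_even_iff_odd.1 (Finset.mem_filter.1 hγ).2.2).neg_one_pow,
      neg_one_mul]
  rw [h3, h4] at h2
  simp only [Finset.prod_const_one, one_mul] at h1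
  have h5 := add_neg_eq_zero.1 h2
  rw [← h5, ← two_mul, mul_left_comm, mul_div_assoc] at h1
  have h6 := mul_left_cancel₀ two_ne_zero h1
  exact ⟨h6, h5 ▸ h6⟩

theorem sum_descentClass_of_zero_mem [CharZero K] {q : K} (hq : ∀ k, 1 ≤ k → qInt q k ≠ 0)
    {stat : List ℤ → ℕ} (hs : IsMahonian q stat) (hn : 1 ≤ n) {M : Finset ℕ}
    (hM : M ⊆ Finset.range n) (h0 : 0 ∈ M) :
    ∑ γ ∈ descentClass n M, q ^ signedStat stat γ.1 =
      qMultinomial q n (parts n M) * ∏ i ∈ Finset.Ico 1 n, (1 + q ^ i) := by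
  classical
  rw [sum_descentClass M fun γ => q ^ signedStat stat γ, qMultinomial, prod_parts q hM,
    div_mul_eq_mul_div, ← (sum_isShuffle_parity hq hs hn M).1]
  refine Finset.sum_congr (Finset.filter_congr fun γ _ => ?_) fun _ _ => rfl
  rw [InClass, IsShuffle]
  tauto

theorem start_eq_zero_iff {M : Finset ℕ} (h0 : 0 ∉ M) {a : ℕ} :
    start M a = 0 ↔ ∀ m ∈ M, a ≤ m := by
  constructor
  · intro h m hm
    by_contra hlt
    have := le_start hm (not_le.1 hlt)
    have h1 : m = 0 := by omega
    exact h0 (h1 ▸ hm)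
  · intro h
    rw [start, Finset.filter_false_of_mem fun m hm => not_lt.2 (h m hm)]
    rfl

theorem le_elem_one_iff {M : Finset ℕ} {a : ℕ} (ha : a ≤ n) :
    a ≤ elem n M 1 ↔ ∀ m ∈ M, a ≤ m := by
  have hs : ∀ m, m ∈ M ↔ m ∈ M.sort := fun m => (Finset.mem_sort _).symm
  have hp := Finset.pairwise_sort M (· ≤ ·)
  rw [elem, elems]
  simp only [hs]
  rcases hL : M.sort with _ | ⟨x, L⟩
  · rw [hL]
    simpa using ha
  · rw [hL, List.pairwise_cons] at hp
    rw [hL]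
    simp only [Nat.sub_self, List.cons_append, List.getD_cons_zero, List.mem_cons, forall_eq_or_imp]
    exact ⟨fun h => ⟨h, fun m hm => h.trans (hp.1 m hm)⟩, fun h => h.1⟩

theorem IsInitial.one_mem {M N : Finset ℕ} (hN : IsInitial n M N) {a : ℕ} (ha : a ∈ N)
    (h : start M a = 0) : 1 ∈ N := by
  have h1 : a ∈ N.filter fun b => start M b = 0 := Finset.mem_filter.2 ⟨ha, h⟩
  have h2 := Finset.card_pos.2 ⟨a, h1⟩
  have h3 : 1 ∈ N.filter fun b => start M b = 0 := by
    rw [hN.filter_start]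
    exact Finset.mem_Ioc.2 ⟨by omega, by omega⟩
  exact (Finset.mem_filter.1 h3).1

/-- Negating `γ⁻¹(1)` turns `γ⁻¹(1) + γ⁻¹(2) > 0` into the absence of a descent at `1`, whether or
not `1 ∈ M`. -/
theorem InClass.flipOne {M : Finset ℕ} (h0 : 0 ∉ M) (hn : 1 ≤ n) {γ : Equiv.Perm (Pt n)}
    (h : InClass M γ) : IsShuffle (M.erase 1) (flipOne hn * γ) := by
  obtain ⟨h1, -, h3, h4⟩ := h
  refine ⟨mul_mem (flipOne_mem_B hn) h1, fun i h5 h6 h7 => ?_⟩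
  rw [win_inv_flipOne_mul hn γ (by omega : 2 ≤ i + 1)]
  rcases eq_or_lt_of_le h5 with rfl | h8
  · rw [win_inv_flipOne_mul_one hn h1]
    have : 0 < win γ⁻¹ 1 + win γ⁻¹ (1 + 1) := h4 (by omega) h0
    omega
  · rw [win_inv_flipOne_mul hn γ h8]
    exact h3 i h5 h6 fun h9 => h7 (Finset.mem_erase.2 ⟨by omega, h9⟩)

/-- If `1 ∉ M`, the image must itself have no inverse descent at `1`, that is `-γ⁻¹(1) < γ⁻¹(2)`;
positivity of `γ⁻¹(1)` ensures this. -/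
theorem IsShuffle.inClass_flipOne {M : Finset ℕ} (hn : 1 ≤ n)
    {γ : Equiv.Perm (Pt n)} (h : IsShuffle (M.erase 1) γ) (he : ¬ Even (negSet γ).card)
    (h1 : 1 ∉ M → 0 < win γ⁻¹ 1) :
    InClass M (TypeD.flipOne hn * γ) := by
  obtain ⟨h2, h3⟩ := h
  refine ⟨mul_mem (flipOne_mem_B hn) h2, (even_negSet_flipOne_mul hn h2).2 he,
    fun i h5 h6 h7 => ?_, fun h5 _ => ?_⟩
  · rw [win_inv_flipOne_mul hn γ (by omega : 2 ≤ i + 1)]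
    have h8 := h3 i h5 h6 fun h9 => h7 (Finset.mem_erase.1 h9).2
    rcases eq_or_lt_of_le h5 with rfl | h9
    · rw [win_inv_flipOne_mul_one hn h2]
      have := h1 h7
      omega
    · rwa [win_inv_flipOne_mul hn γ h9]
  · have h8 : win γ⁻¹ 1 < win γ⁻¹ 2 := h3 1 le_rfl (by omega) (by simp)
    rw [win_inv_flipOne_mul_one hn h2, win_inv_flipOne_mul hn γ le_rfl]
    omega

/-- The sign change identifies the class with the odd elements for `M \ {1}`. There the parts `1`
and `m₂ - 1` are merged into `m₂`, and `[m₂]_q! = [m₂ - 1]_q! [m₂]_q` produces the denominator. -/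
theorem sum_descentClass_of_one_mem [CharZero K] {q : K} (hq : ∀ k, 1 ≤ k → qInt q k ≠ 0)
    {stat : List ℤ → ℕ} (hs : IsMahonian q stat) (ho : IsOrderInvariant stat) (hn : 1 ≤ n)
    {M : Finset ℕ} (hM : M ⊆ Finset.range n) (h0 : 0 ∉ M) (h1 : 1 ∈ M) :
    ∑ γ ∈ descentClass n M, q ^ signedStat stat γ.1 =
      qMultinomial q n (parts n M) *
        ((∏ i ∈ Finset.Ico 1 n, (1 + q ^ i)) / qInt q (elem n M 2)) := by
  classical
  have hM' : M.erase 1 ⊆ Finset.range n := (Finset.erase_subset _ _).trans hM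
  have hsum : ∑ γ : Equiv.Perm (Pt n) with InClass M γ, q ^ signedStat stat γ =
      ∑ γ : Equiv.Perm (Pt n) with IsShuffle (M.erase 1) γ ∧ ¬ Even (negSet γ).card,
        q ^ signedStat stat γ := by
    refine Finset.sum_bij' (fun γ _ => flipOne hn * γ) (fun γ _ => flipOne hn * γ) ?_ ?_ ?_ ?_ ?_
    · intro γ hγ
      have h := (Finset.mem_filter.1 hγ).2
      refine Finset.mem_filter.2 ⟨Finset.mem_univ _, h.flipOne h0 hn, ?_⟩
      rw [even_negSet_flipOne_mul hn h.1, not_not]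
      exact h.2.1
    · intro γ hγ
      have h := (Finset.mem_filter.1 hγ).2
      exact Finset.mem_filter.2 ⟨Finset.mem_univ _,
        h.1.inClass_flipOne hn h.2 fun h3 => absurd h1 h3⟩
    · exact fun γ _ => flipOne_mul_flipOne_mul hn γ
    · exact fun γ _ => flipOne_mul_flipOne_mul hn γ
    · intro γ hγ
      rw [signedStat_flipOne_mul ho hn (Finset.mem_filter.1 hγ).2.1]
  rw [sum_descentClass M fun γ => q ^ signedStat stat γ, hsum,
    (sum_isShuffle_parity hq hs hn (M.erase 1)).2, ← prod_parts q hM', qMultinomial]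
  have hsort : M.sort = 1 :: (M.erase 1).sort := by
    conv_lhs => rw [← Finset.insert_erase h1]
    refine Finset.sort_insert _ (fun b hb => ?_) (by simp)
    have hb' := (Finset.mem_erase.1 hb).2
    have : b ≠ 0 := fun h => h0 (h ▸ hb')
    omega
  obtain ⟨m, L, hL, hm⟩ : ∃ m L, elems n (M.erase 1) = m :: L ∧ 1 ≤ m := by
    rw [elems]
    rcases hL : (M.erase 1).sort with _ | ⟨m, L⟩
    · exact ⟨n, [], by rw [hL]; rfl, hn⟩
    · refine ⟨m, L ++ [n], by rw [hL]; rfl, ?_⟩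
      have h2 : m ∈ M.erase 1 := (Finset.mem_sort (· ≤ ·)).1 (by rw [hL]; simp)
      have : m ≠ 0 := fun h => h0 (h ▸ (Finset.mem_erase.1 h2).2)
      omega
  have hL' : elems n M = 1 :: m :: L := by
    rw [elems, hsort, List.cons_append, ← elems, hL]
  have hp : parts n M = 1 :: (m - 1) :: List.zipWith (fun a b => b - a) (m :: L) L := by
    rw [parts, hL']; rfl
  have hp' : parts n (M.erase 1) = m :: List.zipWith (fun a b => b - a) (m :: L) L := by
    rw [parts, hL]; rfl
  have he : elem n M 2 = m := by rw [elem, hL']; rfl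
  obtain ⟨k, rfl⟩ : ∃ k, m = k + 1 := ⟨m - 1, by omega⟩
  have hone : qFactorial q 1 = 1 := by simp [qFactorial, qInt]
  rw [hp, hp', he, List.map_cons, List.map_cons, List.map_cons, List.prod_cons, List.prod_cons,
    List.prod_cons, hone, one_mul, Nat.add_sub_cancel, qFactorial_succ, div_mul_div_comm]
  congr 1
  ring

theorem sum_descentClass_of_notMem {q : K} (hq : ∀ k, 1 ≤ k → qInt q k ≠ 0)
    {stat : List ℤ → ℕ} (hs : IsMahonian q stat) (ho : IsOrderInvariant stat) (hn : 1 ≤ n)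
    {M : Finset ℕ} (hM : M ⊆ Finset.range n) (h0 : 0 ∉ M) (h1 : 1 ∉ M) :
    ∑ γ ∈ descentClass n M, q ^ signedStat stat γ.1 =
      qMultinomial q n (parts n M) * ∏ i ∈ Finset.Ico (elem n M 1) n, (1 + q ^ i) := by
  classical
  have hMe : M.erase 1 = M := Finset.erase_eq_of_notMem h1
  have hpos : ∀ γ : Equiv.Perm (Pt n), 1 ∉ negSet γ ↔ 0 < win γ⁻¹ 1 := by
    intro γ
    rw [mem_negSet]
    have := win_bounds γ⁻¹ ⟨le_rfl, hn⟩
    omega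
  have hsum : ∑ γ : Equiv.Perm (Pt n) with InClass M γ, q ^ signedStat stat γ =
      ∑ γ : Equiv.Perm (Pt n) with IsShuffle M γ ∧ 1 ∉ negSet γ, q ^ signedStat stat γ := by
    -- When `n ≥ 2` the conditions at `0` and `1` say `|γ⁻¹(1)| < γ⁻¹(2)`, which is insensitive to
    -- the sign of `γ⁻¹(1)`. Each pair `{γ, flipOne hn * γ}` satisfying it has one even member and
    -- one member with the letter `1` positive; the map exchanges these two choices.
    refine Finset.sum_bij' (fun γ _ => if 1 ∈ negSet γ then flipOne hn * γ else γ)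
      (fun γ _ => if Even (negSet γ).card then γ else flipOne hn * γ) ?_ ?_ ?_ ?_ ?_
    · intro γ hγ
      have h := (Finset.mem_filter.1 hγ).2
      refine Finset.mem_filter.2 ⟨Finset.mem_univ _, ?_⟩
      split_ifs with h2
      · refine ⟨hMe ▸ h.flipOne h0 hn, ?_⟩
        rw [one_mem_negSet_flipOne_mul hn h.1, not_not]
        exact h2
      · exact ⟨⟨h.1, h.2.2.1⟩, h2⟩
    · intro γ hγ
      have h := (Finset.mem_filter.1 hγ).2
      have h3 := (hpos γ).1 h.2
      refine Finset.mem_filter.2 ⟨Finset.mem_univ _, ?_⟩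
      split_ifs with h2
      · refine ⟨h.1.1, h2, h.1.2, fun h4 _ => ?_⟩
        have : win γ⁻¹ 1 < win γ⁻¹ 2 := h.1.2 1 le_rfl h4 h1
        omega
      · exact IsShuffle.inClass_flipOne hn (hMe.symm ▸ h.1) h2 fun _ => h3
    · intro γ hγ
      have h := (Finset.mem_filter.1 hγ).2
      split_ifs with h2 h3 h3
      · rw [even_negSet_flipOne_mul hn h.1] at h3
        exact absurd h.2.1 h3
      · exact flipOne_mul_flipOne_mul hn γ
      · rfl
      · exact absurd h.2.1 h3
    · intro γ hγ
      have h := (Finset.mem_filter.1 hγ).2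
      split_ifs with h2 h3 h3
      · exact absurd h3 h.2
      · rfl
      · exact flipOne_mul_flipOne_mul hn γ
      · exact absurd ((one_mem_negSet_flipOne_mul hn h.1.1).2 h.2) h3
    · intro γ hγ
      have h := (Finset.mem_filter.1 hγ).2
      split_ifs with h2
      · rw [signedStat_flipOne_mul ho hn h.1]
      · rfl
  -- As negative sets are initial, the weight `0` on the block after `0` kills exactly the elements
  -- with the letter `1` negative.
  have hmain := sum_signedStat hq hs n M (fun s => if s = 0 then 0 else 1)
  have hleft : ∑ γ : Equiv.Perm (Pt n) with IsShuffle M γ,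
      (∏ a ∈ negSet γ, if start M a = 0 then (0 : K) else 1) * q ^ signedStat stat γ =
      ∑ γ : Equiv.Perm (Pt n) with IsShuffle M γ ∧ 1 ∉ negSet γ, q ^ signedStat stat γ := by
    rw [← Finset.filter_filter, Finset.sum_filter (fun γ => 1 ∉ negSet γ)]
    refine Finset.sum_congr rfl fun γ hγ => ?_
    have h := (Finset.mem_filter.1 hγ).2
    by_cases h2 : 1 ∈ negSet γ
    · rw [if_neg (not_not.2 h2), Finset.prod_eq_zero h2, zero_mul]
      rw [if_pos]
      have := start_lt (M := M) (le_refl 1)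
      omega
    · rw [if_pos h2, Finset.prod_eq_one, one_mul]
      exact fun a ha => if_neg fun h3 => h2 (h.isInitial_negSet.one_mem ha h3)
  have hright : ∏ a ∈ Finset.Icc 1 n, (1 + (if start M a = 0 then (0 : K) else 1) * q ^ (a - 1)) =
      ∏ i ∈ Finset.Ico (elem n M 1) n, (1 + q ^ i) := by
    have h2 : ∀ a ∈ Finset.Icc 1 n, 1 + (if start M a = 0 then (0 : K) else 1) * q ^ (a - 1) =
        if elem n M 1 ≤ a - 1 then 1 + q ^ (a - 1) else 1 := by
      intro a ha
      have ha' := Finset.mem_Icc.1 ha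
      have h3 := (start_eq_zero_iff h0).trans (le_elem_one_iff ha'.2).symm
      by_cases h4 : start M a = 0
      · rw [if_pos h4, if_neg (by have := h3.1 h4; omega), zero_mul, add_zero]
      · rw [if_neg h4, if_pos (by have := mt h3.2 h4; omega), one_mul]
    rw [Finset.prod_congr rfl h2, ← Finset.Ico_add_one_right_eq_Icc,
      ← Finset.prod_Ico_add' _ 0 n 1]
    simp only [Nat.add_sub_cancel]
    rw [← Finset.prod_filter]
    congr 1
    ext i
    simp only [Finset.mem_filter, Finset.mem_Ico]
    omega
  rw [hleft, hright] at hmain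
  rw [sum_descentClass M fun γ => q ^ signedStat stat γ, hsum, hmain, qMultinomial,
    prod_parts q hM, div_mul_eq_mul_div]

/-- As a polynomial it takes the value `k` at `1`. -/
theorem qInt_X_ne_zero (k : ℕ) (hk : 1 ≤ k) : qInt (RatFunc.X : RatFunc ℚ) k ≠ 0 := by
  have h : qInt (RatFunc.X : RatFunc ℚ) k = algebraMap (Polynomial ℚ) (RatFunc ℚ)
      (∑ i ∈ Finset.range k, Polynomial.X ^ i) := by
    simp [qInt, map_sum]
  rw [h]
  refine RatFunc.algebraMap_ne_zero fun h0 => ?_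
  have := congrArg (Polynomial.eval 1) h0
  simp [Polynomial.eval_finsetSum] at this
  omega

end Main

end TypeD

theorem mainTheorem1 (n : ℕ) (hn : 1 ≤ n) (M : Finset ℕ) (hM : M ⊆ Finset.range n)
    (q : RatFunc ℚ) (hq : q = RatFunc.X) :
    (∑ γ ∈ TypeD.descentClass n M, q ^ TypeD.dmaj γ =
      ∑ γ ∈ TypeD.descentClass n M, q ^ TypeD.length γ) ∧
    (0 ∈ M →
      ∑ γ ∈ TypeD.descentClass n M, q ^ TypeD.length γ =
        TypeD.qMultinomial q n (TypeD.parts n M) * ∏ i ∈ Finset.Ico 1 n, (1 + q ^ i)) ∧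
    (0 ∉ M → 1 ∉ M →
      ∑ γ ∈ TypeD.descentClass n M, q ^ TypeD.length γ =
        TypeD.qMultinomial q n (TypeD.parts n M) *
          ∏ i ∈ Finset.Ico (TypeD.elem n M 1) n, (1 + q ^ i)) ∧
    (0 ∉ M → 1 ∈ M →
      ∑ γ ∈ TypeD.descentClass n M, q ^ TypeD.length γ =
        TypeD.qMultinomial q n (TypeD.parts n M) *
          ((∏ i ∈ Finset.Ico 1 n, (1 + q ^ i)) / TypeD.qInt q (TypeD.elem n M 2))) := by
  have hq' : ∀ k, 1 ≤ k → TypeD.qInt q k ≠ 0 := hq ▸ TypeD.qInt_X_ne_zero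
  have hinv := TypeD.isMahonian_revInv q
  have hmaj := TypeD.isMahonian_revMaj q
  have oinv := TypeD.isOrderInvariant_revInv
  have omaj := TypeD.isOrderInvariant_revMaj
  have h1 : ∑ γ ∈ TypeD.descentClass n M, q ^ TypeD.dmaj γ =
      ∑ γ ∈ TypeD.descentClass n M, q ^ TypeD.signedStat TypeD.revMaj γ.1 :=
    Finset.sum_congr rfl fun γ _ => by rw [TypeD.dmaj_eq, TypeD.signedStat]
  have h2 : ∑ γ ∈ TypeD.descentClass n M, q ^ TypeD.length γ =
      ∑ γ ∈ TypeD.descentClass n M, q ^ TypeD.signedStat TypeD.revInv γ.1 :=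
    Finset.sum_congr rfl fun γ _ => by rw [TypeD.length_eq, TypeD.signedStat]
  rw [h1, h2]
  refine ⟨?_, TypeD.sum_descentClass_of_zero_mem hq' hinv hn hM,
    TypeD.sum_descentClass_of_notMem hq' hinv oinv hn hM,
    TypeD.sum_descentClass_of_one_mem hq' hinv oinv hn hM⟩
  by_cases h0 : 0 ∈ M
  · rw [TypeD.sum_descentClass_of_zero_mem hq' hmaj hn hM h0,
      TypeD.sum_descentClass_of_zero_mem hq' hinv hn hM h0]
  · by_cases h3 : 1 ∈ M
    · rw [TypeD.sum_descentClass_of_one_mem hq' hmaj omaj hn hM h0 h3,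
        TypeD.sum_descentClass_of_one_mem hq' hinv oinv hn hM h0 h3]
    · rw [TypeD.sum_descentClass_of_notMem hq' hmaj omaj hn hM h0 h3,
        TypeD.sum_descentClass_of_notMem hq' hinv oinv hn hM h0 h3]
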